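/- Let $G$ be a real Lie group with Lie algebra $\mathfrak g$, let $p\colon P\to M$ be a smooth principal $G$-bundle (right action $R_g$, infinitesimal action $z\mapsto Y_z$), and let $\hat E\to P$ be an exact Courant algebroid with pairing $\langle\cdot,\cdot\rangle$, anchor $\pi$ and Dorfman bracket $[\cdot,\cdot]$, so that $0\to T^*P\xrightarrow{\pi^*}\hat E\xrightarrow{\pi}TP\to0$ is exact, where $\pi^*$ is the dual of $\pi$ and $\hat E^*\cong\hat E$ by the pairing (with $\langle [s,s],t\rangle=\tfrac12\pi(t)\langle s,s\rangle$). Let $\rho\colon\mathfrak g\to\Gamma(\hat E)$ be a lift of the $G$-action: a linear map with $\rho([z,w])=[\rho(z),\rho(w)]$ and $\pi(\rho(z))=Y_z$, such that the infinitesimal action $s\mapsto[\rho(z),s]$ on $\Gamma(\hat E)$ integrates to a smooth right $G$-action on $\hat E$ by Courant algebroid automorphisms covering the action on $P$. Assume that $\rho$ is equivariant, $\rho(\operatorname{Ad}(g)z)=g\,\rho(z)$, where $(g\,s)(q)=s(q\cdot g)\cdot g^{-1}$ for $s\in\Gamma(\hat E)$, and that $\hat E$ admits at least one $G$-equivariant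 isotropic splitting $TP\to\hat E$ of $\pi$. Put $c(z,w)=-\langle\rho(z),\rho(w)\rangle$; this is a symmetric bilinear form on $\mathfrak g$, depending on the point of $P$ in a locally constant way only (so it is an invariant form on $\mathfrak g$ if $P$ is connected). An isotropic splitting $\lambda$ gives an isomorphism $\lambda+\tfrac12\pi^*\colon TP\oplus T^*P\to\hat E$ and a curvature $3$-form $\hat H\in\Omega^3(P)$, $\hat H(X,Y,Z)=2\langle[\lambda X,\lambda Y],\lambda Z\rangle$; equivalently, the bracket of $\hat E$ becomes $[X+\xi,Y+\eta]=L_X(Y+\eta)-i_Yd\xi+i_Yi_X\hat H$. For a connection $A$ on $P$, viewed as a $\mathfrak g$-valued $1$-form with $A(Y_z)=z$, put $A^\perp X=X-Y_{AX}$, let $F(X,Y)=-A[A^\perp X,A^\perp Y]$ be its curvature, and let $CS(A)=-\tfrac16c(A\wedge[A,A])+c(F\wedge A)$, that is, $$CS(A)(X,Y,Z)=-c(AX,[AY,AZ])+c(F(X,Y),AZ)-c(F(X,Z),AY)+c(F(Y,Z),AX),$$ where $[AY,AZ]$ is the bracket of $\mathfrak g$, taken pointwise. Then for every connection $A$ there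 are a $G$-equivariant isotropic splitting $\lambda\colon TP\to\hat E$ and a $3$-form $H\in\Omega^3(M)$ such that, under $\lambda+\tfrac12\pi^*$, $$\rho(z)=Y_z-c(z,A\,\cdot)\quad(z\in\mathfrak g),\qquad \hat H=-CS(A)+p^*H .$$ This splitting is unique up to basic $B$-field transformations: if $(\lambda,H)$ and $(\lambda',H')$ both have these properties, then $\lambda'=e^{p^*b}\lambda$ for some $b\in\Omega^2(M)$, where $(e^{p^*b}\lambda)(X)=\lambda(X)+\tfrac12\pi^*(i_X p^*b)$; conversely, if $(\lambda,H)$ has these properties and $b\in\Omega^2(M)$, then $e^{p^*b}\lambda$ is a $G$-equivariant isotropic splitting that has them too, with some $H'\in\Omega^3(M)$. -/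

import Mathlib

open Bundle MulOpposite
open scoped Manifold ContDiff

noncomputable section

namespace LiftedAction

/-! ### Smooth differential forms -/

section Forms

variable {EM : Type*} [NormedAddCommGroup EM] [NormedSpace ℝ EM]
  (M : Type*) [TopologicalSpace M] [ChartedSpace EM M] [IsManifold 𝓘(ℝ, EM) ∞ M]

/-- Smooth vector fields on a manifold. -/
abbrev VectorFields : Type _ :=
  Cₛ^∞⟮𝓘(ℝ, EM); EM, (fun x : M => TangentSpace 𝓘(ℝ, EM) x)⟯

/-- Smooth differential `k`-forms: families of alternating forms on the tangent spaces whose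
value on any `k` smooth vector fields is a smooth function. -/
structure DiffForm (k : ℕ) where
  toFun : ∀ x : M, TangentSpace 𝓘(ℝ, EM) x [⋀^Fin k]→ₗ[ℝ] ℝ
  smooth : ∀ X : Fin k → VectorFields (EM := EM) M,
    ContMDiff 𝓘(ℝ, EM) 𝓘(ℝ, ℝ) ∞ (fun x => toFun x (fun i => X i x))

/-- The contraction `i_v β = β(v, ·)` of a 2-form on a vector space. -/
def contract {V : Type*} [AddCommGroup V] [Module ℝ V] (β : V [⋀^Fin 2]→ₗ[ℝ] ℝ) (v : V) :
    Module.Dual ℝ V where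
  toFun w := β ![v, w]
  map_add' w w' := by
    have e : ∀ u, Function.update ![v, 0] 1 u = ![v, u] := fun u => by
      ext i; fin_cases i <;> simp
    simpa only [e] using β.map_update_add ![v, 0] 1 w w'
  map_smul' a w := by
    have e : ∀ u, Function.update ![v, 0] 1 u = ![v, u] := fun u => by
      ext i; fin_cases i <;> simp
    simpa only [e, RingHom.id_apply] using β.map_update_smul ![v, 0] 1 a w

end Forms

/-! ### Exact Courant algebroids -/

section Courant

variable {EP : Type*} [NormedAddCommGroup EP] [NormedSpace ℝ EP]
  {P : Type*} [TopologicalSpace P] [ChartedSpace EP P] [IsManifold 𝓘(ℝ, EP) ∞ P]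
  (F : Type*) [NormedAddCommGroup F] [NormedSpace ℝ F]
  (E : P → Type*) [TopologicalSpace (TotalSpace F E)]
  [∀ p, TopologicalSpace (E p)] [∀ p, AddCommGroup (E p)] [∀ p, Module ℝ (E p)]
  [FiberBundle F E] [VectorBundle ℝ F E]

/-- Smooth sections `Γ(E)` of a vector bundle. -/
abbrev Sections : Type _ := Cₛ^∞⟮𝓘(ℝ, EP); F, E⟯

/-- A Courant algebroid structure on the smooth vector bundle `E → P`, in terms of the
(non-skew) Dorfman bracket. -/
structure CourantAlgebroid where
  /-- the fibrewise pairing `⟨·,·⟩` -/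
  pairing : ∀ p, LinearMap.BilinForm ℝ (E p)
  pairing_symm : ∀ p, (pairing p).IsSymm
  pairing_nondegenerate : ∀ p, (pairing p).Nondegenerate
  pairing_smooth : ∀ s t : Sections (EP := EP) F E,
    ContMDiff 𝓘(ℝ, EP) 𝓘(ℝ, ℝ) ∞ (fun p => pairing p (s p) (t p))
  /-- the anchor `π : E → TP` -/
  anchor : ∀ p, E p →ₗ[ℝ] TangentSpace 𝓘(ℝ, EP) p
  anchor_smooth : ∀ s : Sections (EP := EP) F E,
    ContMDiff 𝓘(ℝ, EP) (𝓘(ℝ, EP).prod 𝓘(ℝ, EP)) ∞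
      (fun p => (⟨p, anchor p (s p)⟩ : TangentBundle 𝓘(ℝ, EP) P))
  /-- the bracket on smooth sections -/
  bracket : Sections (EP := EP) F E →ₗ[ℝ] Sections (EP := EP) F E →ₗ[ℝ] Sections (EP := EP) F E
  jacobi : ∀ r s t, bracket r (bracket s t) = bracket (bracket r s) t + bracket s (bracket r t)
  anchor_bracket : ∀ s t p, anchor p (bracket s t p) =
    VectorField.mlieBracket 𝓘(ℝ, EP) (fun q => anchor q (s q)) (fun q => anchor q (t q)) p
  /-- `[s, f t] = f [s, t] + (π(s) f) t` -/
  leibniz : ∀ (f : P → ℝ), ContMDiff 𝓘(ℝ, EP) 𝓘(ℝ, ℝ) ∞ f →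
    ∀ s t t' : Sections (EP := EP) F E, (∀ p, t' p = f p • t p) → ∀ p,
      bracket s t' p = f p • bracket s t p +
        NormedSpace.fromTangentSpace (𝕜 := ℝ) (f p)
          (mfderiv 𝓘(ℝ, EP) 𝓘(ℝ, ℝ) f p (anchor p (s p))) • t p
  /-- `π(r)⟨s, t⟩ = ⟨[r, s], t⟩ + ⟨s, [r, t]⟩` -/
  invariant : ∀ (r s t : Sections (EP := EP) F E) (p : P),
    NormedSpace.fromTangentSpace (𝕜 := ℝ) (pairing p (s p) (t p))
      (mfderiv 𝓘(ℝ, EP) 𝓘(ℝ, ℝ) (fun q => pairing q (s q) (t q)) p (anchor p (r p))) =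
    pairing p (bracket r s p) (t p) + pairing p (s p) (bracket r t p)
  /-- `⟨[s, s], t⟩ = ½ π(t)⟨s, s⟩` -/
  bracket_self : ∀ (s t : Sections (EP := EP) F E) (p : P),
    pairing p (bracket s s p) (t p) = (1 / 2 : ℝ) *
      NormedSpace.fromTangentSpace (𝕜 := ℝ) (pairing p (s p) (s p))
        (mfderiv 𝓘(ℝ, EP) 𝓘(ℝ, ℝ) (fun q => pairing q (s q) (s q)) p (anchor p (t p)))

variable {F E}

theorem finiteDimensional_fiber [FiniteDimensional ℝ F] (p : P) : FiniteDimensional ℝ (E p) :=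
  ((trivializationAt F E p).continuousLinearEquivAt ℝ p
    (mem_baseSet_trivializationAt F E p)).symm.toLinearEquiv.finiteDimensional

variable [FiniteDimensional ℝ F]

/-- The dual `π^* : T^*P → E^* ≅ E` of the anchor, with `E^*` identified with `E` by the pairing. -/
def CourantAlgebroid.coanchor (C : CourantAlgebroid (EP := EP) F E) (p : P) :
    Module.Dual ℝ (TangentSpace 𝓘(ℝ, EP) p) →ₗ[ℝ] E p :=
  haveI : FiniteDimensional ℝ (E p) := finiteDimensional_fiber (F := F) p
  ((C.pairing p).toDual (C.pairing_nondegenerate p)).symm.toLinearMap ∘ₗ (C.anchor p).dualMap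

theorem CourantAlgebroid.pairing_coanchor (C : CourantAlgebroid (EP := EP) F E) (p : P)
    (ξ : Module.Dual ℝ (TangentSpace 𝓘(ℝ, EP) p)) (e : E p) :
    C.pairing p (C.coanchor p ξ) e = ξ (C.anchor p e) := by
  have : FiniteDimensional ℝ (E p) := finiteDimensional_fiber (F := F) p
  simp [CourantAlgebroid.coanchor]

/-- The sequence `0 → T^*P → E → TP → 0` is exact. -/
structure CourantAlgebroid.IsExact (C : CourantAlgebroid (EP := EP) F E) : Prop where
  injective : ∀ p, Function.Injective (C.coanchor p)
  exact : ∀ p, Function.Exact (C.coanchor p) (C.anchor p)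
  surjective : ∀ p, Function.Surjective (C.anchor p)

end Courant

/-! ### Principal bundles and connections -/

section Principal

variable {EG : Type*} [NormedAddCommGroup EG] [NormedSpace ℝ EG]
  (G : Type*) [TopologicalSpace G] [ChartedSpace EG G] [Group G]
  {EM : Type*} [NormedAddCommGroup EM] [NormedSpace ℝ EM]
  {M : Type*} [TopologicalSpace M] [ChartedSpace EM M]
  {EP : Type*} [NormedAddCommGroup EP] [NormedSpace ℝ EP]
  {P : Type*} [TopologicalSpace P] [ChartedSpace EP P] [MulAction Gᵐᵒᵖ P]

/-- `pr : P → M` is a smooth principal `G`-bundle; the right action is `p · g = op g • p`. -/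
structure IsPrincipalBundle (pr : P → M) : Prop where
  smooth_act : ContMDiff (𝓘(ℝ, EP).prod 𝓘(ℝ, EG)) 𝓘(ℝ, EP) ∞ (fun x : P × G => op x.2 • x.1)
  smooth_proj : ContMDiff 𝓘(ℝ, EP) 𝓘(ℝ, EM) ∞ pr
  proj_act : ∀ (g : G) (p : P), pr (op g • p) = pr p
  /-- around each point of `M` there is a smooth `G`-equivariant trivialization -/
  locally_trivial : ∀ x : M, ∃ e : Trivialization G pr, x ∈ e.baseSet ∧
    ContMDiffOn 𝓘(ℝ, EP) (𝓘(ℝ, EM).prod 𝓘(ℝ, EG)) ∞ e e.source ∧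
    ContMDiffOn (𝓘(ℝ, EM).prod 𝓘(ℝ, EG)) 𝓘(ℝ, EP) ∞ e.toOpenPartialHomeomorph.symm e.target ∧
    ∀ p ∈ e.source, ∀ g : G, (e (op g • p)).2 = (e p).2 * g

variable {G}

/-- The adjoint action `Ad(g)` on the Lie algebra: the derivative at `1` of `h ↦ g h g⁻¹`. -/
def Ad (g : G) : GroupLieAlgebra 𝓘(ℝ, EG) G →ₗ[ℝ] GroupLieAlgebra 𝓘(ℝ, EG) G :=
  show EG →ₗ[ℝ] EG from
    (mfderiv 𝓘(ℝ, EG) 𝓘(ℝ, EG) (fun h : G => g * h * g⁻¹) 1 : EG →L[ℝ] EG).toLinearMap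

/-- The infinitesimal action `ψ(z) = Y_z`: at `p` it is the derivative at `1` of `g ↦ p · g`, in
the direction `z`. -/
def infAct (p : P) : GroupLieAlgebra 𝓘(ℝ, EG) G →ₗ[ℝ] TangentSpace 𝓘(ℝ, EP) p :=
  show EG →ₗ[ℝ] EP from
    (mfderiv 𝓘(ℝ, EG) 𝓘(ℝ, EP) (fun g : G => op g • p) 1 : EG →L[ℝ] EP).toLinearMap

/-- The differential of the right translation `p ↦ p · g`. -/
def dAct (g : G) (p : P) :
    TangentSpace 𝓘(ℝ, EP) p →ₗ[ℝ] TangentSpace 𝓘(ℝ, EP) (op g • p) :=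
  (mfderiv 𝓘(ℝ, EP) 𝓘(ℝ, EP) (fun q : P => op g • q) p).toLinearMap

variable (EG G EP P) in
/-- A connection on a principal bundle `P`. The vertical bundle `VP` is identified with `P × 𝔤`
through `z ↦ Y_z`, so that the equivariant projection `TP → VP` is `v ↦ Y_{A v}`, with `A` a
`𝔤`-valued one-form. -/
structure Connection [IsManifold 𝓘(ℝ, EP) ∞ P] where
  toFun : ∀ p : P, TangentSpace 𝓘(ℝ, EP) p →ₗ[ℝ] GroupLieAlgebra 𝓘(ℝ, EG) G
  smooth : ∀ X : VectorFields (EM := EP) P,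
    ContMDiff (M' := EG) 𝓘(ℝ, EP) 𝓘(ℝ, EG) ∞ (fun p => toFun p (X p))
  vertical : ∀ p z, toFun p (infAct p z) = z
  equivariant : ∀ (g : G) (p : P) (v : TangentSpace 𝓘(ℝ, EP) p),
    toFun (op g • p) (dAct g p v) = Ad g⁻¹ (toFun p v)

variable [IsManifold 𝓘(ℝ, EP) ∞ P]

/-- The horizontal projection `A^⊥ v = v - Y_{A v}`. -/
def Connection.hor (A : Connection EG G EP P) (p : P) :
    TangentSpace 𝓘(ℝ, EP) p →ₗ[ℝ] TangentSpace 𝓘(ℝ, EP) p :=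
  LinearMap.id - infAct p ∘ₗ A.toFun p

/-- The curvature `F(X, Y) = -A[A^⊥X, A^⊥Y]`, as a `𝔤`-valued function. -/
def Connection.curv (A : Connection EG G EP P) (X Y : VectorFields (EM := EP) P) (p : P) :
    GroupLieAlgebra 𝓘(ℝ, EG) G :=
  -A.toFun p (VectorField.mlieBracket 𝓘(ℝ, EP) (fun q => A.hor q (X q)) (fun q => A.hor q (Y q)) p)

end Principal

/-! ### Lifted actions -/

section Lift

variable {EG : Type*} [NormedAddCommGroup EG] [NormedSpace ℝ EG]
  {G : Type*} [TopologicalSpace G] [ChartedSpace EG G] [Group G]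
  {EM : Type*} [NormedAddCommGroup EM] [NormedSpace ℝ EM]
  {M : Type*} [TopologicalSpace M] [ChartedSpace EM M] [IsManifold 𝓘(ℝ, EM) ∞ M]
  {EP : Type*} [NormedAddCommGroup EP] [NormedSpace ℝ EP]
  {P : Type*} [TopologicalSpace P] [ChartedSpace EP P] [IsManifold 𝓘(ℝ, EP) ∞ P]
  [MulAction Gᵐᵒᵖ P]
  {F : Type*} [NormedAddCommGroup F] [NormedSpace ℝ F]
  {E : P → Type*} [TopologicalSpace (TotalSpace F E)]
  [∀ p, TopologicalSpace (E p)] [∀ p, AddCommGroup (E p)] [∀ p, Module ℝ (E p)]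
  [FiberBundle F E] [VectorBundle ℝ F E]

variable (EG G) in
/-- A smooth right action of `G` on the Courant algebroid `E` by automorphisms, covering the
action on `P`. -/
structure RightAction (C : CourantAlgebroid (EP := EP) F E) where
  toFun : ∀ (g : G) (p : P), E p ≃ₗ[ℝ] E (op g • p)
  smooth : ContMDiff (𝓘(ℝ, EG).prod (𝓘(ℝ, EP).prod 𝓘(ℝ, F))) (𝓘(ℝ, EP).prod 𝓘(ℝ, F)) ∞
    (fun x : G × TotalSpace F E => (⟨op x.1 • x.2.1, toFun x.1 x.2.1 x.2.2⟩ : TotalSpace F E))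
  one_act : ∀ (p : P) (e : E p), (⟨op (1 : G) • p, toFun 1 p e⟩ : TotalSpace F E) = ⟨p, e⟩
  mul_act : ∀ (g h : G) (p : P) (e : E p),
    (⟨op (g * h) • p, toFun (g * h) p e⟩ : TotalSpace F E) =
      ⟨op h • op g • p, toFun h (op g • p) (toFun g p e)⟩
  map_pairing : ∀ (g : G) (p : P) (e e' : E p),
    C.pairing (op g • p) (toFun g p e) (toFun g p e') = C.pairing p e e'
  map_anchor : ∀ (g : G) (p : P) (e : E p),
    C.anchor (op g • p) (toFun g p e) = dAct g p (C.anchor p e)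
  /-- if `g` carries the section `s` to `s'` and `t` to `t'`, it carries `[s, t]` to `[s', t']` -/
  map_bracket : ∀ (g : G) (s t s' t' : Sections (EP := EP) F E),
    (∀ p, toFun g p (s p) = s' (op g • p)) → (∀ p, toFun g p (t p) = t' (op g • p)) →
    ∀ p, toFun g p (C.bracket s t p) = C.bracket s' t' (op g • p)

variable (EG G) in
/-- A `G`-equivariant lift of the `G`-action to the Courant algebroid `E`. -/
structure EquivariantLift (C : CourantAlgebroid (EP := EP) F E) where
  /-- the map `ρ : 𝔤 → Γ(E)` -/
  rho : GroupLieAlgebra 𝓘(ℝ, EG) G →ₗ[ℝ] Sections (EP := EP) F E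
  /-- `ρ` is a morphism of algebras -/
  map_bracket : ∀ z w, rho ⁅z, w⁆ = C.bracket (rho z) (rho w)
  /-- `π ∘ ρ = ψ` -/
  anchor_rho : ∀ z p, C.anchor p (rho z p) = infAct p z
  /-- the right action of `G` on `E` -/
  act : RightAction EG G C
  /-- The action integrates the infinitesimal action `s ↦ [ρ(z), s]` of `𝔤` on `Γ(E)`: the
  derivative at `g = 1`, in the direction `z`, of the curve `g ↦ (s(p · g)) · g⁻¹` in the
  vector space `E p` is `[ρ(z), s](p)`. The derivative is tested against linear functionals. -/
  integrates : ∀ (z : GroupLieAlgebra 𝓘(ℝ, EG) G) (s : Sections (EP := EP) F E) (p : P)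
    (φ : Module.Dual ℝ (E p)),
    (mfderiv 𝓘(ℝ, EG) 𝓘(ℝ, ℝ) (fun g : G => φ ((act.toFun g p).symm (s (op g • p)))) 1 z : ℝ) =
      φ (C.bracket (rho z) s p)
  /-- `ρ(Ad(g) z) = g ρ(z)`, where `(g s)(p) = (s(p · g)) · g⁻¹` for a section `s` -/
  equivariant : ∀ (g : G) (z : GroupLieAlgebra 𝓘(ℝ, EG) G) (p : P),
    rho (Ad g z) p = (act.toFun g p).symm (rho z (op g • p))

variable {C : CourantAlgebroid (EP := EP) F E}

/-- The value of `ρ` at a point, `𝔤 → E_p`. -/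
def EquivariantLift.rhoAt (L : EquivariantLift EG G C) (p : P) :
    GroupLieAlgebra 𝓘(ℝ, EG) G →ₗ[ℝ] E p where
  toFun z := L.rho z p
  map_add' z w := by simp
  map_smul' a z := by simp

/-- The symmetric bilinear form on `𝔤` attached to the lift, `c(z, w) = -⟨ρ(z), ρ(w)⟩`, that is,
the polarization of the quadratic form `c(z) = -⟨ρ(z), ρ(z)⟩`. It is evaluated at a point `p`, on
which it depends in a locally constant way only, since `d⟨ρ(z), ρ(z)⟩ = 2⟨[ρ(z), ρ(z)], ·⟩ = 0`. -/
def EquivariantLift.form (L : EquivariantLift EG G C) (p : P) :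
    LinearMap.BilinForm ℝ (GroupLieAlgebra 𝓘(ℝ, EG) G) :=
  -(C.pairing p).compl₁₂ (L.rhoAt p) (L.rhoAt p)

/-- An equivariant isotropic splitting `TP → E` of the anchor. -/
structure Splitting (L : EquivariantLift EG G C) where
  toFun : ∀ p : P, TangentSpace 𝓘(ℝ, EP) p →ₗ[ℝ] E p
  smooth : ∀ X : VectorFields (EM := EP) P,
    ContMDiff 𝓘(ℝ, EP) (𝓘(ℝ, EP).prod 𝓘(ℝ, F)) ∞
      (fun p => (⟨p, toFun p (X p)⟩ : TotalSpace F E))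
  anchor_splitting : ∀ p v, C.anchor p (toFun p v) = v
  isotropic : ∀ p v w, C.pairing p (toFun p v) (toFun p w) = 0
  equivariant : ∀ (g : G) (p : P) (v : TangentSpace 𝓘(ℝ, EP) p),
    toFun (op g • p) (dAct g p v) = L.act.toFun g p (toFun p v)

variable {L : EquivariantLift EG G C}

/-- The section `λX` of `E`, for a vector field `X`. -/
def Splitting.lift (lam : Splitting L) (X : VectorFields (EM := EP) P) :
    Sections (EP := EP) F E :=
  ⟨fun p => lam.toFun p (X p), lam.smooth X⟩

/-- The curvature 3-form `Ĥ` of a splitting, evaluated on vector fields. It is the 3-form in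
`[λX, λY] = λ[X, Y] + ½ π^*(i_Y i_X Ĥ)`, the form of the Dorfman bracket in the presentation
`λ + ½ π^* : TP ⊕ T^*P ≅ E`; pairing with `λZ` gives `½ Ĥ(X, Y, Z)`. -/
def Splitting.curvature (lam : Splitting L) (X Y Z : VectorFields (EM := EP) P) (p : P) : ℝ :=
  2 * C.pairing p (C.bracket (lam.lift X) (lam.lift Y) p) (lam.lift Z p)

/-- The Chern-Simons 3-form `CS(A) = -(1/6) c(A ∧ [A, A]) + c(F ∧ A)`, evaluated on vector
fields. -/
def chernSimons (L : EquivariantLift EG G C) (A : Connection EG G EP P)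
    (X Y Z : VectorFields (EM := EP) P) (p : P) : ℝ :=
  -L.form p (A.toFun p (X p)) ⁅A.toFun p (Y p), A.toFun p (Z p)⁆
    + L.form p (A.curv X Y p) (A.toFun p (Z p))
    - L.form p (A.curv X Z p) (A.toFun p (Y p))
    + L.form p (A.curv Y Z p) (A.toFun p (X p))

/-- The pullback along `pr : P → M` of a `k`-form on `M`, at the point `p`. -/
def pullback {k : ℕ} (pr : P → M) (H : DiffForm (EM := EM) M k) (p : P) :
    TangentSpace 𝓘(ℝ, EP) p [⋀^Fin k]→ₗ[ℝ] ℝ :=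
  (H.toFun (pr p)).compLinearMap (mfderiv 𝓘(ℝ, EP) 𝓘(ℝ, EM) pr p).toLinearMap

variable [FiniteDimensional ℝ F]

/-- The presentation of the lifted action and of the curvature that is adapted to `A`:
`ρ(z) = Y_z - c(z, A ·)` under the isomorphism `λ + ½ π^* : TP ⊕ T^*P ≅ E`, and
`Ĥ = -CS(A) + pr^* H`. -/
structure IsPreferred (pr : P → M) (A : Connection EG G EP P) (lam : Splitting L)
    (H : DiffForm (EM := EM) M 3) : Prop where
  rho_eq : ∀ z p, L.rho z p = lam.toFun p (infAct p z) +
    (1 / 2 : ℝ) • C.coanchor p (-(L.form p z ∘ₗ A.toFun p))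
  curvature_eq : ∀ (X Y Z : VectorFields (EM := EP) P) (p : P),
    lam.curvature X Y Z p = -chernSimons L A X Y Z p + pullback pr H p ![X p, Y p, Z p]

/-- `λ' = e^{pr^* b} λ` for a 2-form `b` on `M`, that is, `λ'(v) = λ(v) + i_v (pr^* b)` under the
isomorphism `λ + ½ π^* : TP ⊕ T^*P ≅ E`. -/
def IsBasicBTransform (pr : P → M) (b : DiffForm (EM := EM) M 2) (lam lam' : Splitting L) : Prop :=
  ∀ (p : P) (v : TangentSpace 𝓘(ℝ, EP) p), lam'.toFun p v = lam.toFun p v +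
    (1 / 2 : ℝ) • C.coanchor p
      (contract (pullback pr b p) v)

end Lift

end LiftedAction

namespace LiftedAction

open Filter Topology Module

/-! ### Frames, tensoriality and smoothness criteria -/

section Frames

variable {EB : Type*} [NormedAddCommGroup EB] [NormedSpace ℝ EB] [FiniteDimensional ℝ EB]
  {B : Type*} [TopologicalSpace B] [ChartedSpace EB B] [IsManifold 𝓘(ℝ, EB) ∞ B] [T2Space B]
  {F : Type*} [NormedAddCommGroup F] [NormedSpace ℝ F] [FiniteDimensional ℝ F]
  {V : B → Type*} [TopologicalSpace (TotalSpace F V)]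
  [∀ p, TopologicalSpace (V p)] [∀ p, AddCommGroup (V p)] [∀ p, Module ℝ (V p)]
  [FiberBundle F V] [VectorBundle ℝ F V] [ContMDiffVectorBundle ∞ F V 𝓘(ℝ, EB)]

/-! The whole statement is governed by the formula for `ρ`: once a splitting `λ` satisfies it
(`IsAdapted`), the formula for the curvature follows.

Existence (`exists_isAdapted`). Start from any equivariant isotropic splitting `λ` and look for `λ +
½ π^* i_v B`. Pairing the wanted formula with `e ∈ E` and using that `ker π` is isotropic gives
`B(Y_z, w) = 2⟨ρ(z), λw⟩ + c(z, Aw)`. These values are compatible with skewness, and `B` is fixed by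
letting it vanish on pairs of horizontal vectors. Everything used is equivariant, hence so is `B`.

Curvature (`IsAdapted.curvature_eq`). Put `σ = ρ(z) - λY_z = -½ π^* c(z, A·)`. Differentiating the
equivariance of `λ` shows that `[ρ(z), ·]` preserves the image of `λ`, so `⟨[ρ(z), λX], λW⟩ = 0`,
and only `σ` contributes to `Ĥ(Y_z, X, W)`. If `⟨σ, λX⟩` and `⟨σ, λW⟩` have zero derivative, the
Courant axioms move the bracket off `σ` and leave `Ĥ(Y_z, X, W) = c(z, A[X, W])`. The condition
holds when each of `X`, `W` is horizontal or an infinitesimal action `Y_w`. There `A[X, W]` is minus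
the curvature, zero or a Lie bracket, according to the number of vertical arguments. Since `Ĥ` is
tensorial, each argument may be replaced by a horizontal field plus a `Y_w` with the same value at
the point. Expanding gives `-CS(A)` plus the value of `Ĥ` on horizontal parts, which is an invariant
horizontal form and descends to `M` (`exists_pullback_eq`).

Uniqueness. The formula for `ρ` determines `λ` on vertical vectors, so two adapted splittings differ
by an invariant 2-form that annihilates vertical vectors, hence by a basic one. Conversely a basic
form does not change `λY_z`, so the formula for `ρ` persists and the curvature formula follows
again. -/

/-- Global smooth sections that form a frame near `p`, with smooth global coordinate
functionals. -/
theorem exists_global_frame (p : B) :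
    ∃ (n : ℕ) (W : Fin n → Sections (EP := EB) F V) (a : Fin n → ∀ q, V q →ₗ[ℝ] ℝ),
      (∀ i, ContMDiff (𝓘(ℝ, EB).prod 𝓘(ℝ, F)) 𝓘(ℝ, ℝ) ∞
        (fun e : TotalSpace F V => a i e.1 e.2)) ∧
      (∀ᶠ q in 𝓝 p, ∀ v : V q, ∑ i, a i q v • W i q = v) ∧
      (∀ᶠ q in 𝓝 p, ∀ i j, a i q (W j q) = if i = j then 1 else 0) := by
  let t := trivializationAt F V p
  have hp : t.baseSet ∈ 𝓝 p :=
    t.open_baseSet.mem_nhds (FiberBundle.mem_baseSet_trivializationAt F V p)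
  obtain ⟨χ, -, hχ⟩ := (SmoothBumpFunction.nhds_basis_tsupport (I := 𝓘(ℝ, EB)) p).mem_iff.1 hp
  let b := finBasis ℝ F
  have hW : ∀ i, ContMDiff 𝓘(ℝ, EB) (𝓘(ℝ, EB).prod 𝓘(ℝ, F)) ∞
      (fun q => (⟨q, χ q • t.symm q (b i)⟩ : TotalSpace F V)) := by
    intro i
    refine ContMDiffOn.smul_section_of_tsupport (F := F) (ψ := χ) (u := t.baseSet)
      (s := fun q => t.symm q (b i)) χ.contMDiff.contMDiffOn t.open_baseSet hχ ?_
    have := t.contMDiffOn_symm (IB := 𝓘(ℝ, EB)) (n := ∞)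
    have h2 : ContMDiffOn 𝓘(ℝ, EB) (𝓘(ℝ, EB).prod 𝓘(ℝ, F)) ∞
        (fun q : B => (q, b i)) t.baseSet := contMDiffOn_id.prodMk contMDiffOn_const
    refine (this.comp h2 (fun q hq => ?_)).congr (fun q hq => ?_)
    · rw [t.target_eq]; exact ⟨hq, trivial⟩
    · exact t.mk_symm hq (b i)
  -- The same cutoff multiplies frame and coordinates, making both global; near `p` it equals `1`
  -- and they are dual to each other.
  let a : Fin (finrank ℝ F) → ∀ q, V q →ₗ[ℝ] ℝ :=
    fun i q => χ q • (b.coord i ∘ₗ t.linearMapAt ℝ q)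
  refine ⟨finrank ℝ F, fun i => ⟨_, hW i⟩, a, ?_, ?_, ?_⟩
  · intro i e
    by_cases he : e.1 ∈ t.baseSet
    · have h1 : ContMDiffAt (𝓘(ℝ, EB).prod 𝓘(ℝ, F)) 𝓘(ℝ, F) ∞
          (fun e : TotalSpace F V => (t e).2) e :=
        ((t.contMDiffOn (IB := 𝓘(ℝ, EB)) (n := ∞)).contMDiffAt
          (t.open_source.mem_nhds (t.mem_source.2 he))).snd
      have h2 : ContMDiffAt (𝓘(ℝ, EB).prod 𝓘(ℝ, F)) 𝓘(ℝ, ℝ) ∞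
          (fun e : TotalSpace F V => χ e.1) e :=
        (χ.contMDiff.contMDiffAt (x := e.1)).comp e (contMDiffAt_proj V)
      have h3 : ContMDiffAt (𝓘(ℝ, EB).prod 𝓘(ℝ, F)) 𝓘(ℝ, ℝ) ∞
          (fun e : TotalSpace F V => (b.coord i).toContinuousLinearMap (t e).2) e :=
        ((b.coord i).toContinuousLinearMap.contMDiff.contMDiffAt).comp e h1
      refine (h2.mul h3).congr_of_eventuallyEq ?_
      filter_upwards [t.open_source.mem_nhds (t.mem_source.2 he)] with e' he'
      have := t.mem_source.1 he'
      simp only [a, LinearMap.smul_apply, LinearMap.comp_apply, smul_eq_mul,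
        LinearMap.coe_toContinuousLinearMap']
      rw [t.coe_linearMapAt_of_mem this]
      rfl
    · have hnot : e.1 ∉ tsupport χ := fun h => he (hχ h)
      have : ∀ᶠ e' : TotalSpace F V in 𝓝 e, χ e'.1 = 0 := by
        have := (FiberBundle.continuous_proj F V).continuousAt (x := e)
          ((isClosed_tsupport χ).isOpen_compl.mem_nhds hnot)
        filter_upwards [this] with e' he'
        exact image_eq_zero_of_notMem_tsupport he'
      refine (contMDiffAt_const (c := (0 : ℝ))).congr_of_eventuallyEq ?_
      filter_upwards [this] with e' he'
      simp [a, he']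
  · filter_upwards [χ.eventuallyEq_one, hp] with q hq hq' v
    simp only [ContMDiffSection.coeFn_mk, a, LinearMap.comp_apply, hq,
      Pi.one_apply, one_smul]
    have : ∀ i, t.symm q (b i) = t.symmL ℝ q (b i) := fun i => (t.symmL_apply hq' _).symm
    simp only [this, ← map_smul, ← map_sum]
    simp only [Basis.coord_apply, b.sum_repr]
    exact t.symmL_continuousLinearMapAt hq' v
  · filter_upwards [χ.eventuallyEq_one, hp] with q hq hq' i j
    simp only [ContMDiffSection.coeFn_mk, a, LinearMap.comp_apply, hq,
      Pi.one_apply, one_smul]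
    rw [t.linearMapAt_symm hq']
    simp [Finsupp.single_apply, eq_comm]

/-- Linearity of the extension is the point: composing with it turns an alternating map on vector
fields into one on the tangent space. -/
theorem exists_linear_extension (p : B) :
    ∃ ext : V p →ₗ[ℝ] Sections (EP := EB) F V, ∀ v, ext v p = v := by
  obtain ⟨n, W, a, -, h, -⟩ := exists_global_frame (EB := EB) (F := F) (V := V) p
  refine ⟨∑ i, (a i p).smulRight (W i), fun v => ?_⟩
  have : ∀ s : Finset (Fin n),
      (∑ i ∈ s, (a i p).smulRight (W i)) v p = ∑ i ∈ s, a i p v • W i p := by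
    intro s
    induction s using Finset.induction_on with
    | empty => simp
    | insert i s hi ih => simp [Finset.sum_insert hi, ← ih]
  rw [this]; exact h.self_of_nhds v

variable {EN : Type*} [NormedAddCommGroup EN] [NormedSpace ℝ EN]
  {N : Type*} [TopologicalSpace N] [ChartedSpace EN N]

/-- A family of multilinear maps that is smooth on global smooth sections is smooth on sections
along a map. -/
theorem contMDiffAt_multilinear {k : ℕ} (T : ∀ q, MultilinearMap ℝ (fun _ : Fin k => V q) ℝ)
    (hT : ∀ X : Fin k → Sections (EP := EB) F V,
      ContMDiff 𝓘(ℝ, EB) 𝓘(ℝ, ℝ) ∞ (fun q => T q (fun i => X i q)))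
    {f : N → B} {u : ∀ x, Fin k → V (f x)} {x₀ : N}
    (hf : ContMDiffAt 𝓘(ℝ, EN) 𝓘(ℝ, EB) ∞ f x₀)
    (hu : ∀ i, ContMDiffAt 𝓘(ℝ, EN) (𝓘(ℝ, EB).prod 𝓘(ℝ, F)) ∞
      (fun x => (⟨f x, u x i⟩ : TotalSpace F V)) x₀) :
    ContMDiffAt 𝓘(ℝ, EN) 𝓘(ℝ, ℝ) ∞ (fun x => T (f x) (u x)) x₀ := by
  obtain ⟨n, W, a, ha, h, -⟩ := exists_global_frame (EB := EB) (F := F) (V := V) (f x₀)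
  have key : ContMDiffAt 𝓘(ℝ, EN) 𝓘(ℝ, ℝ) ∞ (fun x => ∑ r : Fin k → Fin n,
      (∏ i, a (r i) (f x) (u x i)) * T (f x) (fun i => W (r i) (f x))) x₀ := by
    refine contMDiffAt_finsetSum fun r _ => ContMDiffAt.mul ?_ ?_
    · refine contMDiffAt_finsetProd fun i _ => ?_
      exact ((ha (r i)).contMDiffAt).comp x₀ (hu i)
    · exact ((hT fun i => W (r i)).contMDiffAt).comp x₀ hf
  refine key.congr_of_eventuallyEq ?_
  filter_upwards [hf.continuousAt h] with x hx
  have hx' : ∀ v : V (f x), ∑ i, a i (f x) v • W i (f x) = v := hx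
  conv_lhs => rw [← funext fun i => hx' (u x i)]
  rw [MultilinearMap.map_sum]
  refine Finset.sum_congr rfl fun r _ => ?_
  rw [MultilinearMap.map_smul_univ, smul_eq_mul]

/-- A section is smooth if its pairings with smooth sections are, for a smooth nondegenerate
pairing. -/
theorem contMDiff_of_pairing (g : ∀ p, LinearMap.BilinForm ℝ (V p))
    (hg : ∀ p, (g p).Nondegenerate)
    (hgs : ∀ s t : Sections (EP := EB) F V,
      ContMDiff 𝓘(ℝ, EB) 𝓘(ℝ, ℝ) ∞ (fun p => g p (s p) (t p)))
    (s : ∀ p, V p)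
    (hs : ∀ t : Sections (EP := EB) F V,
      ContMDiff 𝓘(ℝ, EB) 𝓘(ℝ, ℝ) ∞ (fun p => g p (s p) (t p))) :
    ContMDiff 𝓘(ℝ, EB) (𝓘(ℝ, EB).prod 𝓘(ℝ, F)) ∞ (fun p => (⟨p, s p⟩ : TotalSpace F V)) := by
  intro p
  obtain ⟨n, W, a, ha, h, h'⟩ := exists_global_frame (EB := EB) (F := F) (V := V) p
  -- The coordinates `x` of `s` in the frame solve `m x = y` with `m` the Gram matrix, so Cramer's
  -- rule writes them as smooth functions wherever `det m ≠ 0`.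
  let m : B → Matrix (Fin n) (Fin n) ℝ := fun q => Matrix.of fun i j => g q (W j q) (W i q)
  let y : B → Fin n → ℝ := fun q i => g q (s q) (W i q)
  have hdetne : (m p).det ≠ 0 := by
    intro h0
    -- A kernel vector of the Gram matrix would be a combination of the frame orthogonal to all of
    -- `V p`.
    obtain ⟨v, hv, hv0⟩ := Matrix.exists_mulVec_eq_zero_iff.2 h0
    apply hv
    have hz : ∑ j, v j • W j p = 0 := by
      refine (hg p).1 _ fun w => ?_
      rw [← h.self_of_nhds w]
      simp only [map_sum, map_smul, LinearMap.sum_apply, LinearMap.smul_apply, smul_eq_mul]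
      refine Finset.sum_eq_zero fun i _ => ?_
      have := congrFun hv0 i
      simp only [Matrix.mulVec, dotProduct, m, Matrix.of_apply, Pi.zero_apply] at this
      rw [← mul_zero (a i p w), ← this]
      congr 1
      exact Finset.sum_congr rfl fun j _ => mul_comm _ _
    ext i
    have := congrArg (a i p) hz
    simpa [h'.self_of_nhds] using this
  have hm : ∀ i j, ContMDiffAt 𝓘(ℝ, EB) 𝓘(ℝ, ℝ) ∞ (fun q => m q i j) p := fun i j =>
    (hgs (W j) (W i)).contMDiffAt
  have hdet : ∀ m' : B → Matrix (Fin n) (Fin n) ℝ,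
      (∀ i j, ContMDiffAt 𝓘(ℝ, EB) 𝓘(ℝ, ℝ) ∞ (fun q => m' q i j) p) →
      ContMDiffAt 𝓘(ℝ, EB) 𝓘(ℝ, ℝ) ∞ (fun q => (m' q).det) p := by
    intro m' hm'
    simp only [Matrix.det_apply']
    exact contMDiffAt_finsetSum fun σ _ => contMDiffAt_const.mul
      (contMDiffAt_finsetProd fun i _ => hm' _ _)
  have hcr : ∀ j, ContMDiffAt 𝓘(ℝ, EB) 𝓘(ℝ, ℝ) ∞ (fun q => (m q).cramer (y q) j) p := by
    intro j
    simp only [Matrix.cramer_apply]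
    refine hdet _ fun i k => ?_
    by_cases hk : k = j
    · subst hk; simpa using (hs (W i)).contMDiffAt (x := p)
    · simpa [Matrix.updateCol_apply, hk] using hm i k
  have hinv : ContMDiffAt 𝓘(ℝ, EB) 𝓘(ℝ, ℝ) ∞ (fun q => ((m q).det)⁻¹) p :=
    (contDiffAt_inv ℝ hdetne).contMDiffAt.comp p (hdet m hm)
  have key : ContMDiffAt 𝓘(ℝ, EB) (𝓘(ℝ, EB).prod 𝓘(ℝ, F)) ∞
      (fun q => (⟨q, ∑ j, (((m q).det)⁻¹ * (m q).cramer (y q) j) • W j q⟩ : TotalSpace F V)) p := by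
    refine ContMDiffAt.sum_section (t := fun j q => (((m q).det)⁻¹ * (m q).cramer (y q) j) • W j q)
      fun j _ => ?_
    exact (hinv.mul (hcr j)).smul_section (W j).contMDiff.contMDiffAt
  refine key.congr_of_eventuallyEq ?_
  filter_upwards [h, (hdet m hm).continuousAt.eventually_ne hdetne] with q hq hne
  congr 1
  conv_lhs => rw [← hq (s q)]
  refine Finset.sum_congr rfl fun j _ => ?_
  congr 1
  have hmy : (m q).mulVec (fun j => a j q (s q)) = y q := by
    ext i
    simp only [Matrix.mulVec, dotProduct, m, y, Matrix.of_apply]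
    conv_rhs => rw [← hq (s q)]
    simp only [map_sum, map_smul, LinearMap.sum_apply, LinearMap.smul_apply, smul_eq_mul]
    exact Finset.sum_congr rfl fun j _ => mul_comm _ _
  have : (m q).cramer (y q) = (m q).det • fun j => a j q (s q) := by
    rw [← hmy, Matrix.cramer_eq_adjugate_mulVec, Matrix.mulVec_mulVec, Matrix.adjugate_mul,
      Matrix.smul_mulVec, Matrix.one_mulVec]
  rw [this, Pi.smul_apply, smul_eq_mul, inv_mul_cancel_left₀ hne]

end Frames

/-! ### Basic forms on principal bundles -/

section Basic

variable {EG : Type*} [NormedAddCommGroup EG] [NormedSpace ℝ EG]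
  {G : Type*} [TopologicalSpace G] [ChartedSpace EG G] [Group G]
  {EM : Type*} [NormedAddCommGroup EM] [NormedSpace ℝ EM]
  {M : Type*} [TopologicalSpace M] [ChartedSpace EM M]
  {EP : Type*} [NormedAddCommGroup EP] [NormedSpace ℝ EP]
  {P : Type*} [TopologicalSpace P] [ChartedSpace EP P] [MulAction Gᵐᵒᵖ P] {pr : P → M}

/-- In a trivialization, `s` is the slice of constant group coordinate through `p`, and `τ` is the
group coordinate relative to that of `p`, so that `q = s(pr q) · τ(q)` near `p`. -/
theorem IsPrincipalBundle.exists_local_section [LieGroup 𝓘(ℝ, EG) ∞ G]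
    (hP : IsPrincipalBundle (EG := EG) (EM := EM) (EP := EP) G pr) (p : P) :
    ∃ (s : M → P) (τ : P → G), s (pr p) = p ∧ τ p = 1 ∧
      (∀ᶠ x in 𝓝 (pr p), ContMDiffAt 𝓘(ℝ, EM) 𝓘(ℝ, EP) ∞ s x) ∧
      (∀ᶠ x in 𝓝 (pr p), pr (s x) = x) ∧
      ContMDiffAt 𝓘(ℝ, EP) 𝓘(ℝ, EG) ∞ τ p ∧ ∀ᶠ q in 𝓝 p, op (τ q) • s (pr q) = q := by
  obtain ⟨e, hx, he, hes, heq⟩ := hP.locally_trivial (pr p)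
  have hp : p ∈ e.source := e.mem_source.2 hx
  have hmem : ∀ x ∈ e.baseSet, (x, (e p).2) ∈ e.target := fun x hx => e.mem_target.2 hx
  have hprs : ∀ x ∈ e.baseSet, pr (e.toOpenPartialHomeomorph.symm (x, (e p).2)) = x :=
    fun x hx => e.proj_symm_apply (hmem x hx)
  refine ⟨fun x => e.toOpenPartialHomeomorph.symm (x, (e p).2),
    fun q => (e p).2⁻¹ * (e q).2, e.symm_apply_mk_proj hp, inv_mul_cancel _, ?_, ?_, ?_, ?_⟩
  · filter_upwards [e.open_baseSet.mem_nhds hx] with x hx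
    exact (hes.contMDiffAt (e.open_target.mem_nhds (hmem x hx))).comp x
      (contMDiffAt_id.prodMk contMDiffAt_const)
  · filter_upwards [e.open_baseSet.mem_nhds hx] with x hx using hprs x hx
  · exact (contMDiff_mul_left (I := 𝓘(ℝ, EG)) (n := ∞) (a := (e p).2⁻¹)).contMDiffAt.comp p
      (he.contMDiffAt (e.open_source.mem_nhds hp)).snd
  · filter_upwards [e.open_source.mem_nhds hp] with q hq
    have hqb := e.mem_source.1 hq
    have hs : e.toOpenPartialHomeomorph.symm (pr q, (e p).2) ∈ e.source :=
      e.mem_source.2 (by rw [hprs _ hqb]; exact hqb)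
    have hs' : op ((e p).2⁻¹ * (e q).2) • e.toOpenPartialHomeomorph.symm (pr q, (e p).2) ∈
        e.source := e.mem_source.2 (by rw [hP.proj_act, hprs _ hqb]; exact hqb)
    refine e.toOpenPartialHomeomorph.injOn hs' hq (Prod.ext ?_ ?_)
    · change (e _).1 = (e q).1
      rw [e.coe_fst hs', e.coe_fst hq, hP.proj_act, hprs _ hqb]
    · change (e _).2 = (e q).2
      rw [heq _ hs, e.apply_symm_apply (hmem _ hqb), mul_inv_cancel_left]

theorem IsPrincipalBundle.exists_smul_eq
    (hP : IsPrincipalBundle (EG := EG) (EM := EM) (EP := EP) G pr) {p q : P} (h : pr p = pr q) :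
    ∃ g : G, op g • p = q := by
  obtain ⟨e, hx, he, hes, heq⟩ := hP.locally_trivial (pr q)
  have hq : q ∈ e.source := e.mem_source.2 hx
  have hp : p ∈ e.source := e.mem_source.2 (h ▸ hx)
  have hp' : op ((e p).2⁻¹ * (e q).2) • p ∈ e.source :=
    e.mem_source.2 (by rw [hP.proj_act, h]; exact hx)
  refine ⟨(e p).2⁻¹ * (e q).2, e.toOpenPartialHomeomorph.injOn hp' hq (Prod.ext ?_ ?_)⟩
  · change (e _).1 = (e q).1
    rw [e.coe_fst hp', e.coe_fst hq, hP.proj_act, h]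
  · change (e _).2 = (e q).2
    rw [heq _ hp, mul_inv_cancel_left]

theorem IsPrincipalBundle.surjective
    (hP : IsPrincipalBundle (EG := EG) (EM := EM) (EP := EP) G pr) : Function.Surjective pr := by
  intro x
  obtain ⟨e, hx, -⟩ := hP.locally_trivial x
  exact ⟨_, e.proj_symm_apply (x := (x, (1 : G))) (e.mem_target.2 hx)⟩

theorem IsPrincipalBundle.contMDiff_smul
    (hP : IsPrincipalBundle (EG := EG) (EM := EM) (EP := EP) G pr) (g : G) :
    ContMDiff 𝓘(ℝ, EP) 𝓘(ℝ, EP) ∞ (fun p : P => op g • p) :=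
  hP.smooth_act.comp (contMDiff_id.prodMk contMDiff_const)

theorem IsPrincipalBundle.contMDiff_orbit
    (hP : IsPrincipalBundle (EG := EG) (EM := EM) (EP := EP) G pr) (p : P) :
    ContMDiff 𝓘(ℝ, EG) 𝓘(ℝ, EP) ∞ (fun g : G => op g • p) :=
  hP.smooth_act.comp (contMDiff_const.prodMk contMDiff_id)

/-- The derivative of a map between manifolds, as a map between the model spaces. -/
def tderiv {E₁ : Type*} [NormedAddCommGroup E₁] [NormedSpace ℝ E₁]
    {E₂ : Type*} [NormedAddCommGroup E₂] [NormedSpace ℝ E₂]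
    {M₁ : Type*} [TopologicalSpace M₁] [ChartedSpace E₁ M₁]
    {M₂ : Type*} [TopologicalSpace M₂] [ChartedSpace E₂ M₂] (f : M₁ → M₂) (x : M₁) : E₁ →L[ℝ] E₂ :=
  mfderiv 𝓘(ℝ, E₁) 𝓘(ℝ, E₂) f x

/-! ### Calculus of derivatives as maps of model spaces -/

section

variable {E₁ : Type*} [NormedAddCommGroup E₁] [NormedSpace ℝ E₁]
  {E₂ : Type*} [NormedAddCommGroup E₂] [NormedSpace ℝ E₂]
  {E₃ : Type*} [NormedAddCommGroup E₃] [NormedSpace ℝ E₃]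
  {M₁ : Type*} [TopologicalSpace M₁] [ChartedSpace E₁ M₁]
  {M₂ : Type*} [TopologicalSpace M₂] [ChartedSpace E₂ M₂]
  {M₃ : Type*} [TopologicalSpace M₃] [ChartedSpace E₃ M₃]

theorem tderiv_comp {g : M₂ → M₃} {f : M₁ → M₂} {x : M₁}
    (hg : MDifferentiableAt 𝓘(ℝ, E₂) 𝓘(ℝ, E₃) g (f x))
    (hf : MDifferentiableAt 𝓘(ℝ, E₁) 𝓘(ℝ, E₂) f x) (v : E₁) :
    tderiv (E₁ := E₁) (E₂ := E₃) (g ∘ f) x v =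
      tderiv (E₁ := E₂) (E₂ := E₃) g (f x) (tderiv (E₁ := E₁) (E₂ := E₂) f x v) :=
  DFunLike.congr_fun (mfderiv_comp x hg hf) v

theorem tderiv_congr {f g : M₁ → M₂} {x : M₁} (h : f =ᶠ[𝓝 x] g) :
    tderiv (E₁ := E₁) (E₂ := E₂) f x = tderiv g x := h.mfderiv_eq

theorem tderiv_id (x : M₁) (v : E₁) : tderiv (E₁ := E₁) (E₂ := E₁) (fun y : M₁ => y) x v = v :=
  DFunLike.congr_fun (mfderiv_id (I := 𝓘(ℝ, E₁)) (x := x)) v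

theorem tderiv_const (x : M₁) (c : M₂) (v : E₁) :
    tderiv (E₁ := E₁) (E₂ := E₂) (fun _ : M₁ => c) x v = 0 :=
  DFunLike.congr_fun (mfderiv_const (I := 𝓘(ℝ, E₁)) (I' := 𝓘(ℝ, E₂)) (x := x) (c := c)) v

end

theorem IsPrincipalBundle.tderiv_proj_dAct
    (hP : IsPrincipalBundle (EG := EG) (EM := EM) (EP := EP) G pr) (g : G) (p : P) (v : EP) :
    tderiv (E₁ := EP) (E₂ := EM) pr (op g • p) (dAct (EP := EP) g p v) = tderiv pr p v := by
  rw [← show pr ∘ (fun q : P => op g • q) = pr from funext (hP.proj_act g)]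
  rw [tderiv_comp (hP.smooth_proj.mdifferentiable (by simp) _)
    ((hP.contMDiff_smul g).mdifferentiable (by simp) p)]
  rw [show pr ∘ (fun q : P => op g • q) = pr from funext (hP.proj_act g)]
  rfl

theorem IsPrincipalBundle.tderiv_proj_infAct
    (hP : IsPrincipalBundle (EG := EG) (EM := EM) (EP := EP) G pr) (p : P) (z : EG) :
    tderiv (E₁ := EP) (E₂ := EM) pr p (infAct (EG := EG) (G := G) (EP := EP) p z) = 0 := by
  have h := tderiv_comp (x := (1 : G)) (g := pr) (f := fun g : G => op g • p)
    (hP.smooth_proj.mdifferentiable (by simp) _)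
    ((hP.contMDiff_orbit p).mdifferentiable (by simp) 1) z
  rw [show pr ∘ (fun g : G => op g • p) = fun _ => pr p from funext fun g => hP.proj_act g p,
    tderiv_const, op_one, one_smul] at h
  exact h.symm

/-- The vertical tangent vectors are the values of the infinitesimal action. -/
theorem IsPrincipalBundle.exists_infAct_eq [LieGroup 𝓘(ℝ, EG) ∞ G]
    (hP : IsPrincipalBundle (EG := EG) (EM := EM) (EP := EP) G pr) (p : P)
    (w : EP) (hw : tderiv (E₁ := EP) (E₂ := EM) pr p w = 0) :
    ∃ z : GroupLieAlgebra 𝓘(ℝ, EG) G, w = infAct (EP := EP) p z := by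
  obtain ⟨s, τ, hs, hτ, hs1, -, hτ1, hsτ⟩ := hP.exists_local_section p
  have hs2 := hs1.self_of_nhds
  have hspr : ContMDiffAt 𝓘(ℝ, EP) 𝓘(ℝ, EP) ∞ (s ∘ pr) p :=
    hs2.comp p hP.smooth_proj.contMDiffAt
  have hact : MDifferentiableAt (𝓘(ℝ, EP).prod 𝓘(ℝ, EG)) 𝓘(ℝ, EP)
      (fun x : P × G => op x.2 • x.1) ((s ∘ pr) p, τ p) :=
    hP.smooth_act.mdifferentiable (by simp) _
  have hpair : MDifferentiableAt 𝓘(ℝ, EP) (𝓘(ℝ, EP).prod 𝓘(ℝ, EG))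
      (fun q => ((s ∘ pr) q, τ q)) p :=
    (hspr.prodMk hτ1).mdifferentiableAt (by simp)
  have h1 := DFunLike.congr_fun (mfderiv_comp p hact hpair) w
  have h2 : mfderiv 𝓘(ℝ, EP) 𝓘(ℝ, EP)
      ((fun x : P × G => op x.2 • x.1) ∘ (fun q => ((s ∘ pr) q, τ q))) p =
      mfderiv 𝓘(ℝ, EP) 𝓘(ℝ, EP) (fun q => q) p := Filter.EventuallyEq.mfderiv_eq hsτ
  have h3 := DFunLike.congr_fun h2 w
  have h4 := mfderiv_prod_eq_add_apply (v := mfderiv 𝓘(ℝ, EP) (𝓘(ℝ, EP).prod 𝓘(ℝ, EG))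
    (fun q => ((s ∘ pr) q, τ q)) p w) hact
  have h5 := DFunLike.congr_fun (mfderiv_prodMk (hspr.mdifferentiableAt (by simp))
    (hτ1.mdifferentiableAt (by simp))) w
  -- The product rule for `q = s(pr q) · τ(q)` at `p`. The first summand factors through the
  -- derivative of `pr` and so vanishes on `w`; the second is an infinitesimal action because `τ p =
  -- 1` and `s (pr p) = p`.
  have h6 : w = tderiv (E₁ := EP) (E₂ := EP) (fun q : P => op (τ p) • q) ((s ∘ pr) p)
      (tderiv (E₁ := EP) (E₂ := EP) (s ∘ pr) p w) +
      tderiv (E₁ := EG) (E₂ := EP) (fun g : G => op g • (s ∘ pr) p) (τ p)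
        (tderiv (E₁ := EP) (E₂ := EG) τ p w) := by
    refine (tderiv_id p w).symm.trans (h3.symm.trans (h1.trans (h4.trans ?_)))
    exact congrArg₂ (fun a b : EP => a + b)
      (congrArg (tderiv (E₁ := EP) (E₂ := EP) (fun q : P => op (τ p) • q) ((s ∘ pr) p))
        (congrArg Prod.fst h5))
      (congrArg (tderiv (E₁ := EG) (E₂ := EP) (fun g : G => op g • (s ∘ pr) p) (τ p))
        (congrArg Prod.snd h5))
  rw [tderiv_comp (g := s) (f := pr) (hs2.mdifferentiableAt (by simp))
    (hP.smooth_proj.mdifferentiable (by simp) p), hw, map_zero, map_zero, zero_add, hτ,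
    Function.comp_apply, hs] at h6
  exact ⟨_, h6⟩

/-- The derivative of a local section through `p` serves. -/
theorem IsPrincipalBundle.exists_rightInverse [LieGroup 𝓘(ℝ, EG) ∞ G]
    (hP : IsPrincipalBundle (EG := EG) (EM := EM) (EP := EP) G pr) (p : P) :
    ∃ D : EM →ₗ[ℝ] EP, ∀ v, tderiv (E₁ := EP) (E₂ := EM) pr p (D v) = v := by
  obtain ⟨s, τ, hs, -, hs1, hs2, -⟩ := hP.exists_local_section p
  refine ⟨(tderiv (E₁ := EM) (E₂ := EP) s (pr p)).toLinearMap, fun v => ?_⟩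
  have h := tderiv_comp (x := pr p) (g := pr) (f := s)
    (hP.smooth_proj.mdifferentiable (by simp) _) (hs1.self_of_nhds.mdifferentiableAt (by simp)) v
  rw [tderiv_congr (f := pr ∘ s) (g := fun x => x) hs2, tderiv_id, hs] at h
  exact h.symm

/-- A multilinear form does not see changes of its arguments in a subspace that it annihilates. -/
theorem multilinear_congr {V : Type*} [AddCommGroup V] [Module ℝ V] {k : ℕ}
    (T : V [⋀^Fin k]→ₗ[ℝ] ℝ) (K : V → Prop)
    (hK : ∀ u i, K (u i) → T u = 0) {u u' : Fin k → V} (h : ∀ i, K (u' i - u i)) :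
    T u = T u' := by
  -- Expand `T(u + (u' - u))` over subsets: every term but `T u` has an entry `u' i - u i`, hence
  -- vanishes.
  have h1 := T.toMultilinearMap.map_add_univ u (u' - u)
  rw [add_sub_cancel, Finset.sum_eq_single Finset.univ] at h1
  · simpa using h1.symm
  · intro s _ hs
    obtain ⟨i, hi⟩ : ∃ i, i ∉ s := by
      by_contra hcon
      push Not at hcon
      exact hs (Finset.eq_univ_iff_forall.2 hcon)
    refine hK _ i ?_
    rw [Finset.piecewise_eq_of_notMem _ _ _ hi]
    exact h i
  · simp

variable [IsManifold 𝓘(ℝ, EM) ∞ M]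

theorem pullback_dAct (hP : IsPrincipalBundle (EG := EG) (EM := EM) (EP := EP) G pr) {k : ℕ}
    (b : DiffForm (EM := EM) M k) (g : G) (p : P) (u : Fin k → TangentSpace 𝓘(ℝ, EP) p) :
    pullback pr b (op g • p) (fun i => dAct g p (u i)) = pullback pr b p u := by
  have h : ∀ x y, x = y → ∀ v w : Fin k → EM, v = w →
      b.toFun x (show Fin k → TangentSpace 𝓘(ℝ, EM) x from v) =
      b.toFun y (show Fin k → TangentSpace 𝓘(ℝ, EM) y from w) := by
    rintro _ _ rfl _ _ rfl; rfl
  exact h _ _ (hP.proj_act g p) _ _ (funext fun i => hP.tderiv_proj_dAct g p (u i))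

theorem contract_pullback_infAct
    (hP : IsPrincipalBundle (EG := EG) (EM := EM) (EP := EP) G pr)
    (b : DiffForm (EM := EM) M 2) (p : P) (z : GroupLieAlgebra 𝓘(ℝ, EG) G) :
    contract (pullback (EP := EP) pr b p) (infAct (EP := EP) p z) = 0 := by
  ext w
  refine (b.toFun (pr p)).map_coord_zero 0 ?_
  exact hP.tderiv_proj_infAct p z

variable [IsManifold 𝓘(ℝ, EP) ∞ P] [T2Space P] [FiniteDimensional ℝ EP]

/-- Invariant horizontal forms descend to the base. -/
theorem IsPrincipalBundle.exists_pullback_eq [LieGroup 𝓘(ℝ, EG) ∞ G]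
    (hP : IsPrincipalBundle (EG := EG) (EM := EM) (EP := EP) G pr) {k : ℕ}
    (T : ∀ p : P, TangentSpace 𝓘(ℝ, EP) p [⋀^Fin k]→ₗ[ℝ] ℝ)
    (hT : ∀ X : Fin k → VectorFields (EM := EP) P,
      ContMDiff 𝓘(ℝ, EP) 𝓘(ℝ, ℝ) ∞ (fun p => T p (fun i => X i p)))
    (hinv : ∀ (g : G) (p : P) (u : Fin k → TangentSpace 𝓘(ℝ, EP) p),
      T (op g • p) (fun i => dAct g p (u i)) = T p u)
    (hhor : ∀ p (u : Fin k → TangentSpace 𝓘(ℝ, EP) p) i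
      (z : GroupLieAlgebra 𝓘(ℝ, EG) G), u i = infAct p z → T p u = 0) :
    ∃ b : DiffForm (EM := EM) M k, ∀ p, pullback pr b p = T p := by
  choose D hD using hP.exists_rightInverse
  have h1 : ∀ (p : P) (u u' : Fin k → TangentSpace 𝓘(ℝ, EP) p),
      (∀ i, tderiv (E₁ := EP) (E₂ := EM) pr p (u i) = tderiv (E₁ := EP) (E₂ := EM) pr p (u' i)) → T p u = T p u' := by
    intro p u u' h
    refine multilinear_congr (T p) (fun w => ∃ z : GroupLieAlgebra 𝓘(ℝ, EG) G, w = infAct p z)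
      (fun u i ⟨z, hz⟩ => hhor p u i z hz) fun i => hP.exists_infAct_eq p _ ?_
    exact (map_sub (tderiv (E₁ := EP) (E₂ := EM) pr p) (u' i : EP) (u i : EP)).trans
      (sub_eq_zero.2 (h i).symm)
  have h2 : ∀ (p q : P) (u : Fin k → TangentSpace 𝓘(ℝ, EP) p)
      (u' : Fin k → TangentSpace 𝓘(ℝ, EP) q), pr p = pr q →
      (∀ i, tderiv (E₁ := EP) (E₂ := EM) pr p (u i) = tderiv (E₁ := EP) (E₂ := EM) pr q (u' i)) → T p u = T q u' := by
    intro p q u u' hpq h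
    obtain ⟨g, rfl⟩ := hP.exists_smul_eq hpq
    rw [← hinv g p u]
    refine h1 _ _ _ fun i => ?_
    rw [← h i]
    exact hP.tderiv_proj_dAct g p (u i)
  -- The set-theoretic section `σ` and the lifts `D` need not be smooth. By `h2` the form on `M`
  -- does not depend on them, so smoothness can be checked with a smooth local section instead.
  let σ : M → P := Function.surjInv hP.surjective
  have hσ : ∀ x, pr (σ x) = x := Function.surjInv_eq hP.surjective
  let b : ∀ x : M, TangentSpace 𝓘(ℝ, EM) x [⋀^Fin k]→ₗ[ℝ] ℝ := fun x =>
    (T (σ x)).compLinearMap (show EM →ₗ[ℝ] EP from D (σ x))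
  have h3 : ∀ (p : P) (x : M) (u : Fin k → TangentSpace 𝓘(ℝ, EP) p)
      (v : Fin k → TangentSpace 𝓘(ℝ, EM) x), pr p = x →
      (∀ i, tderiv (E₁ := EP) (E₂ := EM) pr p (u i) = v i) → b x v = T p u := by
    intro p x u v hpx h
    refine h2 (σ x) p _ u ((hσ x).trans hpx.symm) fun i => ?_
    rw [h i]
    exact hD (σ x) (v i)
  refine ⟨⟨b, fun X x₀ => ?_⟩, fun p => ?_⟩
  · obtain ⟨s, τ, -, -, hs1, hs2, -⟩ := hP.exists_local_section (σ x₀)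
    rw [hσ x₀] at hs1 hs2
    have key : ContMDiffAt 𝓘(ℝ, EM) 𝓘(ℝ, ℝ) ∞
        (fun x => T (s x) (fun i => mfderiv 𝓘(ℝ, EM) 𝓘(ℝ, EP) s x (X i x))) x₀ := by
      refine contMDiffAt_multilinear (F := EP) (V := fun p : P => TangentSpace 𝓘(ℝ, EP) p)
        (fun q => (T q).toMultilinearMap) hT (f := s)
        (u := fun x i => mfderiv 𝓘(ℝ, EM) 𝓘(ℝ, EP) s x (X i x)) hs1.self_of_nhds fun i => ?_
      obtain ⟨U, hU, hUo, hx₀⟩ := eventually_nhds_iff.1 hs1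
      have hsU : ContMDiffOn 𝓘(ℝ, EM) 𝓘(ℝ, EP) ∞ s U := fun x hx => (hU x hx).contMDiffWithinAt
      have h4 := hsU.contMDiffOn_tangentMapWithin (m := ∞) (by simp) hUo.uniqueMDiffOn
      have h5 := (h4.comp (X i).contMDiff.contMDiffOn (s := U) fun x hx => hx).contMDiffAt
        (hUo.mem_nhds hx₀)
      refine h5.congr_of_eventuallyEq ?_
      filter_upwards [hUo.mem_nhds hx₀] with x hx
      simp only [Function.comp_apply, tangentMapWithin, mfderivWithin_of_isOpen hUo hx]
    refine key.congr_of_eventuallyEq ?_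
    filter_upwards [hs1, hs2.eventually_nhds] with x hx hx2
    refine h3 (s x) x _ _ hx2.self_of_nhds fun i => ?_
    have h := tderiv_comp (x := x) (g := pr) (f := s)
      (hP.smooth_proj.mdifferentiable (by simp) _) (hx.mdifferentiableAt (by simp)) (X i x : EM)
    rw [tderiv_congr (f := pr ∘ s) (g := fun x => x) hx2] at h
    exact h.symm.trans (tderiv_id x _)
  · ext u
    exact h3 p (pr p) u _ rfl fun i => rfl

end Basic

/-! ### Alternating maps of low degree -/

section Alternating

variable {V : Type*} [AddCommGroup V] [Module ℝ V]

/-- The alternating map of a bilinear form that vanishes on the diagonal. -/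
def alternatingTwo (f : V →ₗ[ℝ] V →ₗ[ℝ] ℝ) (h : ∀ x, f x x = 0) : V [⋀^Fin 2]→ₗ[ℝ] ℝ where
  toFun v := f (v 0) (v 1)
  map_update_add' v i x y := by
    fin_cases i <;> simp [Function.update]
  map_update_smul' v i a x := by
    fin_cases i <;> simp [Function.update]
  map_eq_zero_of_eq' v i j hv hij := by
    fin_cases i <;> fin_cases j <;> simp_all

theorem fin_three_cases : ∀ i : Fin 3, i = 0 ∨ i = 1 ∨ i = 2 := by decide

/-- The alternating map of a trilinear form that vanishes on adjacent equal arguments. -/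
def alternatingThree (f : V →ₗ[ℝ] V →ₗ[ℝ] V →ₗ[ℝ] ℝ) (h : ∀ x z, f x x z = 0)
    (h' : ∀ x y, f x y y = 0) : V [⋀^Fin 3]→ₗ[ℝ] ℝ where
  toFun v := f (v 0) (v 1) (v 2)
  map_update_add' := by
    intro inst v i x y
    -- The field quantifies over all decidability instances; reduce to the standard one so that
    -- `simp` can evaluate the updates.
    obtain rfl := Subsingleton.elim inst (instDecidableEqFin 3)
    obtain rfl | rfl | rfl := fin_three_cases i <;> simp
  map_update_smul' := by
    intro inst v i a x
    obtain rfl := Subsingleton.elim inst (instDecidableEqFin 3)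
    obtain rfl | rfl | rfl := fin_three_cases i <;> simp
  map_eq_zero_of_eq' v i j hv hij := by
    -- Polarizing the vanishing on the last two arguments gives the vanishing on the outer two.
    have h'' : ∀ x y, f x y x = 0 := fun x y => by
      have := h' x (x + y)
      simp only [map_add, LinearMap.add_apply, h, h', zero_add, add_zero] at this
      exact this
    obtain rfl | rfl | rfl := fin_three_cases i <;> obtain rfl | rfl | rfl := fin_three_cases j <;>
      simp_all

end Alternating

/-! ### Consequences of the Courant algebroid axioms -/

section Courant

variable {EP : Type*} [NormedAddCommGroup EP] [NormedSpace ℝ EP]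
  {P : Type*} [TopologicalSpace P] [ChartedSpace EP P] [IsManifold 𝓘(ℝ, EP) ∞ P]
  {F : Type*} [NormedAddCommGroup F] [NormedSpace ℝ F]
  {E : P → Type*} [TopologicalSpace (TotalSpace F E)]
  [∀ p, TopologicalSpace (E p)] [∀ p, AddCommGroup (E p)] [∀ p, Module ℝ (E p)]
  [FiberBundle F E] [VectorBundle ℝ F E] (C : CourantAlgebroid (EP := EP) F E)

namespace CourantAlgebroid

theorem pairing_comm (p : P) (e e' : E p) : C.pairing p e e' = C.pairing p e' e :=
  (C.pairing_symm p).eq e e'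

theorem ext_pairing {p : P} {e e' : E p} (h : ∀ f, C.pairing p e f = C.pairing p e' f) :
    e = e' := by
  rw [← sub_eq_zero]
  exact (C.pairing_nondegenerate p).1 _ fun f => by simp [h f]

/-- Both sides are the derivative along `π(r)` of the same function. -/
theorem invariant_congr {s t s' t' : Sections (EP := EP) F E}
    (h : ∀ q, C.pairing q (s q) (t q) = C.pairing q (s' q) (t' q)) (r : Sections (EP := EP) F E)
    (p : P) :
    C.pairing p (C.bracket r s p) (t p) + C.pairing p (s p) (C.bracket r t p) =
      C.pairing p (C.bracket r s' p) (t' p) + C.pairing p (s' p) (C.bracket r t' p) := by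
  have key : ∀ f g : P → ℝ, f = g →
      NormedSpace.fromTangentSpace (𝕜 := ℝ) (f p)
        (mfderiv 𝓘(ℝ, EP) 𝓘(ℝ, ℝ) f p (C.anchor p (r p))) =
      NormedSpace.fromTangentSpace (𝕜 := ℝ) (g p)
        (mfderiv 𝓘(ℝ, EP) 𝓘(ℝ, ℝ) g p (C.anchor p (r p))) := by
    rintro f _ rfl; rfl
  exact (C.invariant r s t p).symm.trans ((key _ _ (funext h)).trans (C.invariant r s' t' p))

theorem invariant_of_eq_zero {s t : Sections (EP := EP) F E}
    (h : ∀ q, C.pairing q (s q) (t q) = 0) (r : Sections (EP := EP) F E) (p : P) :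
    C.pairing p (C.bracket r s p) (t p) + C.pairing p (s p) (C.bracket r t p) = 0 := by
  rw [C.invariant_congr (s' := 0) (t' := 0) (fun q => by simp [h q]) r p]
  simp

/-- Both sides equal `½ π(t)⟨s, s⟩`, by `bracket_self` and by invariance. In this form the axiom
involves no derivative of functions. -/
theorem pairing_bracket_self (s t : Sections (EP := EP) F E) (p : P) :
    C.pairing p (C.bracket s s p) (t p) = C.pairing p (C.bracket t s p) (s p) := by
  rw [C.bracket_self s t p, C.invariant t s s p, C.pairing_comm p (s p)]
  ring

/-- The polarization of `⟨[s, s], t⟩ = ½ π(t)⟨s, s⟩`. -/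
theorem pairing_bracket_add_bracket (s s' t : Sections (EP := EP) F E) (p : P) :
    C.pairing p (C.bracket s s' p) (t p) + C.pairing p (C.bracket s' s p) (t p) =
      C.pairing p (C.bracket t s p) (s' p) + C.pairing p (C.bracket t s' p) (s p) := by
  have h := C.pairing_bracket_self (s + s') t p
  have h1 := C.pairing_bracket_self s t p
  have h2 := C.pairing_bracket_self s' t p
  simp only [map_add, LinearMap.add_apply, ContMDiffSection.coe_add, Pi.add_apply] at h
  linarith

variable {C}

theorem IsExact.anchor_coanchor [FiniteDimensional ℝ F] (hC : C.IsExact) (p : P)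
    (ξ : Module.Dual ℝ (TangentSpace 𝓘(ℝ, EP) p)) : C.anchor p (C.coanchor p ξ) = 0 :=
  (hC.exact p).apply_apply_eq_zero ξ

/-- The kernel of the anchor is isotropic. -/
theorem IsExact.pairing_eq_zero [FiniteDimensional ℝ F] (hC : C.IsExact) {p : P} {e e' : E p}
    (he : C.anchor p e = 0) (he' : C.anchor p e' = 0) : C.pairing p e e' = 0 := by
  obtain ⟨ξ, rfl⟩ := (hC.exact p e).1 he
  rw [C.pairing_coanchor, he', map_zero]

end CourantAlgebroid

end Courant

section Lift

variable {EG : Type*} [NormedAddCommGroup EG] [NormedSpace ℝ EG]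
  {G : Type*} [TopologicalSpace G] [ChartedSpace EG G] [Group G]
  {EP : Type*} [NormedAddCommGroup EP] [NormedSpace ℝ EP]
  {P : Type*} [TopologicalSpace P] [ChartedSpace EP P] [IsManifold 𝓘(ℝ, EP) ∞ P]
  [MulAction Gᵐᵒᵖ P]
  {F : Type*} [NormedAddCommGroup F] [NormedSpace ℝ F]
  {E : P → Type*} [TopologicalSpace (TotalSpace F E)]
  [∀ p, TopologicalSpace (E p)] [∀ p, AddCommGroup (E p)] [∀ p, Module ℝ (E p)]
  [FiberBundle F E] [VectorBundle ℝ F E] {C : CourantAlgebroid (EP := EP) F E}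
  {L : EquivariantLift EG G C}

/-! ### The adjoint action and the lift -/

theorem Ad_Ad_inv [LieGroup 𝓘(ℝ, EG) ∞ G] (g : G) (z : GroupLieAlgebra 𝓘(ℝ, EG) G) :
    Ad g (Ad g⁻¹ z) = z := by
  have hs : ∀ a b : G, ContMDiff 𝓘(ℝ, EG) 𝓘(ℝ, EG) ∞ (fun h : G => a * h * b) := fun a b =>
    (contMDiff_const.mul contMDiff_id).mul contMDiff_const
  have h := tderiv_comp (E₁ := EG) (E₂ := EG) (E₃ := EG) (x := (1 : G)) (g := fun h : G => g * h * g⁻¹)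
    (f := fun h : G => g⁻¹ * h * g⁻¹⁻¹) ((hs _ _).mdifferentiable (by simp) _)
    ((hs _ _).mdifferentiable (by simp) _) z
  have e : (fun h : G => g * h * g⁻¹) ∘ (fun h : G => g⁻¹ * h * g⁻¹⁻¹) = fun h => h := by
    funext h
    simp [mul_assoc]
  rw [e, show g⁻¹ * 1 * g⁻¹⁻¹ = 1 by simp] at h
  exact h.symm.trans (tderiv_id (E₁ := EG) (1 : G) z)

theorem groupLieAlgebra_bracket_add_swap (z w : GroupLieAlgebra 𝓘(ℝ, EG) G) :
    ⁅z, w⁆ + ⁅w, z⁆ = 0 := by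
  rw [GroupLieAlgebra.bracket_def, GroupLieAlgebra.bracket_def,
    VectorField.mlieBracket_swap_apply, neg_add_cancel]

namespace EquivariantLift

theorem act_rho [LieGroup 𝓘(ℝ, EG) ∞ G] (L : EquivariantLift EG G C) (g : G)
    (z : GroupLieAlgebra 𝓘(ℝ, EG) G) (p : P) :
    L.act.toFun g p (L.rho z p) = L.rho (Ad g⁻¹ z) (op g • p) := by
  have h := L.equivariant g (Ad g⁻¹ z) p
  rw [Ad_Ad_inv] at h
  rw [h, LinearEquiv.apply_symm_apply]

/-- Apply the anchor to the equivariance of `ρ`. -/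
theorem dAct_infAct [LieGroup 𝓘(ℝ, EG) ∞ G] (L : EquivariantLift EG G C) (g : G)
    (z : GroupLieAlgebra 𝓘(ℝ, EG) G) (p : P) :
    dAct (EP := EP) g p (infAct p z) = infAct (op g • p) (Ad g⁻¹ z) := by
  rw [← L.anchor_rho, ← L.act.map_anchor, L.act_rho, L.anchor_rho]

/-- The infinitesimal action of an element of the Lie algebra, as a vector field. -/
def vert (L : EquivariantLift EG G C) (z : GroupLieAlgebra 𝓘(ℝ, EG) G) :
    VectorFields (EM := EP) P :=
  ⟨fun p => C.anchor p (L.rho z p), C.anchor_smooth (L.rho z)⟩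

theorem vert_apply (L : EquivariantLift EG G C) (z : GroupLieAlgebra 𝓘(ℝ, EG) G) (p : P) :
    L.vert z p = infAct p z := L.anchor_rho z p

theorem form_apply (L : EquivariantLift EG G C) (p : P) (z w : GroupLieAlgebra 𝓘(ℝ, EG) G) :
    L.form p z w = -C.pairing p (L.rho z p) (L.rho w p) := rfl

theorem form_comm (L : EquivariantLift EG G C) (p : P) (z w : GroupLieAlgebra 𝓘(ℝ, EG) G) :
    L.form p z w = L.form p w z := by
  rw [form_apply, form_apply, C.pairing_comm]

/-- The pairings `⟨ρ(z), ρ(w)⟩` are locally constant. -/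
theorem invariant_rho (L : EquivariantLift EG G C) (z w : GroupLieAlgebra 𝓘(ℝ, EG) G)
    (t : Sections (EP := EP) F E) (p : P) :
    C.pairing p (C.bracket t (L.rho z) p) (L.rho w p) +
      C.pairing p (L.rho z p) (C.bracket t (L.rho w) p) = 0 := by
  -- The derivative of `⟨ρ(z), ρ(w)⟩` along `t` is `⟨[ρ(z), ρ(w)] + [ρ(w), ρ(z)], t⟩`, and the
  -- symmetrized bracket is `ρ([z, w] + [w, z]) = 0`.
  rw [C.pairing_comm p (L.rho z p), ← C.pairing_bracket_add_bracket, ← L.map_bracket,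
    ← L.map_bracket, ← LinearMap.add_apply, ← map_add]
  have h : L.rho ⁅z, w⁆ p + L.rho ⁅w, z⁆ p = 0 := by
    rw [← Pi.add_apply, ← ContMDiffSection.coe_add, ← map_add, groupLieAlgebra_bracket_add_swap]
    simp
  rw [h, map_zero, LinearMap.zero_apply]

/-- The section `p ↦ ρ(f(p))(p)` for a smooth function `f` with values in the Lie algebra. -/
theorem contMDiff_rhoAt [FiniteDimensional ℝ EG] (L : EquivariantLift EG G C) (f : P → EG)
    (hf : ContMDiff 𝓘(ℝ, EP) 𝓘(ℝ, EG) ∞ f) :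
    ContMDiff 𝓘(ℝ, EP) (𝓘(ℝ, EP).prod 𝓘(ℝ, F)) ∞
      (fun p => (⟨p, L.rhoAt p (f p)⟩ : TotalSpace F E)) := by
  let b := finBasis ℝ EG
  have hc : ∀ i, ContMDiff 𝓘(ℝ, EP) 𝓘(ℝ, ℝ) ∞ (fun p => b.coord i (f p)) := fun i =>
    (b.coord i).toContinuousLinearMap.contMDiff.comp hf
  have h := ContMDiff.sum_section (s := Finset.univ)
    (t := fun i p => b.coord i (f p) • L.rho (b i) p) (I := 𝓘(ℝ, EP)) (F := F) (n := ∞)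
    (fun i _ => (hc i).smul_section (L.rho (b i)).contMDiff)
  have e : ∀ p, L.rhoAt p (f p) = ∑ i, b.coord i (f p) • L.rho (b i) p := fun p => by
    conv_lhs => rw [← b.sum_repr (f p)]
    exact (map_sum (L.rhoAt p) _ _).trans (Finset.sum_congr rfl fun i _ =>
      (L.rhoAt p).map_smul (b.coord i (f p)) (b i))
  simpa only [e] using h

end EquivariantLift

namespace Connection

theorem hor_apply (A : Connection EG G EP P) (p : P) (v : TangentSpace 𝓘(ℝ, EP) p) :
    A.hor p v = v - infAct p (A.toFun p v) := rfl

theorem toFun_hor (A : Connection EG G EP P) (p : P) (v : TangentSpace 𝓘(ℝ, EP) p) :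
    A.toFun p (A.hor p v) = 0 := by
  rw [hor_apply, map_sub, A.vertical, sub_self]

theorem hor_infAct (A : Connection EG G EP P) (p : P) (z : GroupLieAlgebra 𝓘(ℝ, EG) G) :
    A.hor p (infAct p z) = 0 := by
  rw [hor_apply, A.vertical, sub_self]

theorem hor_dAct [LieGroup 𝓘(ℝ, EG) ∞ G] (A : Connection EG G EP P) (L : EquivariantLift EG G C)
    (g : G) (p : P) (v : TangentSpace 𝓘(ℝ, EP) p) :
    A.hor (op g • p) (dAct g p v) = dAct g p (A.hor p v) := by
  rw [hor_apply, hor_apply, A.equivariant, map_sub, L.dAct_infAct]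

/-- The section `ρ(A X)`. -/
def rhoSection [FiniteDimensional ℝ EG] (A : Connection EG G EP P) (L : EquivariantLift EG G C)
    (X : VectorFields (EM := EP) P) : Sections (EP := EP) F E :=
  ⟨fun p => L.rhoAt p (A.toFun p (X p)), L.contMDiff_rhoAt _ (A.smooth X)⟩

/-- The horizontal part of a vector field. -/
def horField [FiniteDimensional ℝ EG] (A : Connection EG G EP P) (L : EquivariantLift EG G C)
    (X : VectorFields (EM := EP) P) : VectorFields (EM := EP) P :=
  X - ⟨fun p => C.anchor p (A.rhoSection L X p), C.anchor_smooth (A.rhoSection L X)⟩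

theorem horField_apply [FiniteDimensional ℝ EG] (A : Connection EG G EP P)
    (L : EquivariantLift EG G C) (X : VectorFields (EM := EP) P) (p : P) :
    A.horField L X p = A.hor p (X p) := by
  rw [hor_apply, ← L.anchor_rho]
  rfl

end Connection

/-! ### The curvature of a splitting -/

namespace Splitting

variable (lam : Splitting L)

/-- The linear map `X ↦ λX` on vector fields. -/
def liftHom : VectorFields (EM := EP) P →ₗ[ℝ] Sections (EP := EP) F E where
  toFun := lam.lift
  map_add' X Y := by ext p; exact map_add (lam.toFun p) _ _
  map_smul' a X := by ext p; exact map_smul (lam.toFun p) _ _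

theorem liftHom_apply (X : VectorFields (EM := EP) P) (p : P) :
    lam.liftHom X p = lam.toFun p (X p) := rfl

theorem pairing_liftHom (X Y : VectorFields (EM := EP) P) (p : P) :
    C.pairing p (lam.liftHom X p) (lam.liftHom Y p) = 0 := lam.isotropic p _ _

/-- The curvature as a trilinear map on vector fields. -/
def curvatureTrilinear (p : P) : VectorFields (EM := EP) P →ₗ[ℝ] VectorFields (EM := EP) P →ₗ[ℝ]
    VectorFields (EM := EP) P →ₗ[ℝ] ℝ :=
  LinearMap.mk₂ ℝ (fun X Y =>
    { toFun Z := 2 * C.pairing p (C.bracket (lam.liftHom X) (lam.liftHom Y) p) (lam.liftHom Z p)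
      map_add' := fun Z Z' => by simp [mul_add]
      map_smul' := fun a Z => by simp; ring })
    (fun X X' Y => by ext Z; simp [mul_add])
    (fun a X Y => by ext Z; simp; ring)
    (fun X Y Y' => by ext Z; simp [mul_add])
    (fun a X Y => by ext Z; simp; ring)

theorem curvatureTrilinear_apply (p : P) (X Y Z : VectorFields (EM := EP) P) :
    lam.curvatureTrilinear p X Y Z =
      2 * C.pairing p (C.bracket (lam.liftHom X) (lam.liftHom Y) p) (lam.liftHom Z p) := rfl

theorem curvatureTrilinear_eq (p : P) (X Y Z : VectorFields (EM := EP) P) :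
    lam.curvatureTrilinear p X Y Z = lam.curvature X Y Z p := rfl

/-- The curvature as an alternating map on vector fields. -/
def curvatureAlternating (p : P) : VectorFields (EM := EP) P [⋀^Fin 3]→ₗ[ℝ] ℝ :=
  alternatingThree (lam.curvatureTrilinear p)
    (fun X Z => by
      have h1 := C.pairing_bracket_self (lam.liftHom X) (lam.liftHom Z) p
      have h2 := C.invariant_of_eq_zero (lam.pairing_liftHom X X) (lam.liftHom Z) p
      rw [C.pairing_comm p (lam.liftHom X p)] at h2
      rw [curvatureTrilinear_apply, h1]
      linarith)
    (fun X Y => by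
      have h2 := C.invariant_of_eq_zero (lam.pairing_liftHom Y Y) (lam.liftHom X) p
      rw [C.pairing_comm p (lam.liftHom Y p)] at h2
      rw [curvatureTrilinear_apply]
      linarith)

theorem curvatureAlternating_apply (p : P) (X : Fin 3 → VectorFields (EM := EP) P) :
    lam.curvatureAlternating p X = lam.curvature (X 0) (X 1) (X 2) p := rfl

/-- The curvature depends only on the values of the vector fields at the point. -/
theorem curvatureAlternating_congr (p : P) {X Y : Fin 3 → VectorFields (EM := EP) P}
    (h : ∀ i, X i p = Y i p) : lam.curvatureAlternating p X = lam.curvatureAlternating p Y := by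
  -- The last argument is not differentiated, so tensoriality is immediate there; the alternating
  -- property carries it to the other two.
  have h2 : ∀ X : Fin 3 → VectorFields (EM := EP) P, X 2 p = 0 →
      lam.curvatureAlternating p X = 0 := fun X hX => by
    rw [curvatureAlternating_apply, ← curvatureTrilinear_eq, curvatureTrilinear_apply,
      liftHom_apply, hX, map_zero, map_zero, mul_zero]
  refine multilinear_congr (lam.curvatureAlternating p) (fun X => X p = 0) (fun X i hX => ?_)
    (fun i => by simp [h i])
  by_cases hi : i = 2
  · exact h2 X (hi ▸ hX)
  · have := (lam.curvatureAlternating p).map_swap X hi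
    rw [h2 _ (by simpa using hX)] at this
    linarith

end Splitting

end Lift

/-! ### Curvature of adapted splittings -/

section Curvature

variable {EG : Type*} [NormedAddCommGroup EG] [NormedSpace ℝ EG]
  {G : Type*} [TopologicalSpace G] [ChartedSpace EG G] [Group G]
  {EP : Type*} [NormedAddCommGroup EP] [NormedSpace ℝ EP]
  {P : Type*} [TopologicalSpace P] [ChartedSpace EP P] [IsManifold 𝓘(ℝ, EP) ∞ P]
  [MulAction Gᵐᵒᵖ P]
  {F : Type*} [NormedAddCommGroup F] [NormedSpace ℝ F]
  {E : P → Type*} [TopologicalSpace (TotalSpace F E)]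
  [∀ p, TopologicalSpace (E p)] [∀ p, AddCommGroup (E p)] [∀ p, Module ℝ (E p)]
  [FiberBundle F E] [VectorBundle ℝ F E] {C : CourantAlgebroid (EP := EP) F E}
  {L : EquivariantLift EG G C}

namespace CourantAlgebroid

/-- The anchor turns the bracket into the Lie bracket of the anchors. This allows `ρ(w)` in place of
`λY_w` under the anchor. -/
theorem anchor_bracket_congr {s t s' t' : Sections (EP := EP) F E}
    (hs : ∀ q, C.anchor q (s q) = C.anchor q (s' q))
    (ht : ∀ q, C.anchor q (t q) = C.anchor q (t' q)) (p : P) :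
    C.anchor p (C.bracket s t p) = C.anchor p (C.bracket s' t' p) := by
  rw [C.anchor_bracket, C.anchor_bracket, funext hs, funext ht]

end CourantAlgebroid

namespace Splitting

variable (lam : Splitting L)

theorem anchor_liftHom (X : VectorFields (EM := EP) P) (p : P) :
    C.anchor p (lam.liftHom X p) = X p := lam.anchor_splitting p _

theorem symm_act_toFun (g : G) (p : P) (v : TangentSpace 𝓘(ℝ, EP) (op g • p)) :
    (L.act.toFun g p).symm (lam.toFun (op g • p) v) =
      lam.toFun p (C.anchor p ((L.act.toFun g p).symm (lam.toFun (op g • p) v))) := by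
  rw [LinearEquiv.symm_apply_eq, ← lam.equivariant, ← L.act.map_anchor,
    LinearEquiv.apply_symm_apply, lam.anchor_splitting]

/-- The infinitesimal action preserves the image of an equivariant splitting. -/
theorem bracket_rho_liftHom (z : GroupLieAlgebra 𝓘(ℝ, EG) G) (X : VectorFields (EM := EP) P)
    (p : P) :
    C.bracket (L.rho z) (lam.liftHom X) p =
      lam.toFun p (C.anchor p (C.bracket (L.rho z) (lam.liftHom X) p)) := by
  rw [← sub_eq_zero, ← forall_dual_apply_eq_zero_iff ℝ]
  intro φ
  have h1 := L.integrates z (lam.liftHom X) p φ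
  -- The curve `g ↦ (λX)(p · g) · g⁻¹` stays in the image of `λ`, where `λπ` is the identity. So
  -- testing it with `φ` and with `φ ∘ λ ∘ π` gives the same function of `g`, hence the same
  -- derivative.
  have h2 := L.integrates z (lam.liftHom X) p (φ ∘ₗ lam.toFun p ∘ₗ C.anchor p)
  have e : (fun g : G => (φ ∘ₗ lam.toFun p ∘ₗ C.anchor p)
      ((L.act.toFun g p).symm (lam.liftHom X (op g • p)))) =
      fun g : G => φ ((L.act.toFun g p).symm (lam.liftHom X (op g • p))) := by
    funext g
    exact congrArg φ (lam.symm_act_toFun g p _).symm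
  rw [e] at h2
  rw [map_sub, sub_eq_zero]
  exact h1.symm.trans h2

/-- The Lie derivative of a horizontal vector field along the action is horizontal. -/
theorem connection_bracket_rho_liftHom [LieGroup 𝓘(ℝ, EG) ∞ G] (A : Connection EG G EP P)
    (z : GroupLieAlgebra 𝓘(ℝ, EG) G) (X : VectorFields (EM := EP) P)
    (hX : ∀ q, A.toFun q (X q) = 0) (p : P) :
    A.toFun p (C.anchor p (C.bracket (L.rho z) (lam.liftHom X) p)) = 0 := by
  rw [← forall_dual_apply_eq_zero_iff ℝ]
  intro χ
  have h := L.integrates z (lam.liftHom X) p (χ ∘ₗ A.toFun p ∘ₗ C.anchor p)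
  -- Equivariance of `A` makes the transported vectors horizontal for every `g`, so the tested curve
  -- is constant.
  have e : (fun g : G => (χ ∘ₗ A.toFun p ∘ₗ C.anchor p)
      ((L.act.toFun g p).symm (lam.liftHom X (op g • p)))) = fun _ => 0 := by
    funext g
    have h1 := A.equivariant g p
      (C.anchor p ((L.act.toFun g p).symm (lam.liftHom X (op g • p))))
    rw [← L.act.map_anchor, LinearEquiv.apply_symm_apply, anchor_liftHom, hX] at h1
    have h2 := congrArg (Ad g) h1
    rw [Ad_Ad_inv, map_zero] at h2
    exact (congrArg χ h2.symm).trans (map_zero χ)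
  rw [e, mfderiv_const] at h
  exact h.symm

section Preferred

variable [FiniteDimensional ℝ F]

/-- The presentation `ρ(z) = Y_z - c(z, A ·)` of the lifted action. -/
def IsAdapted (A : Connection EG G EP P) : Prop :=
  ∀ z p, L.rho z p = lam.toFun p (infAct p z) +
    (1 / 2 : ℝ) • C.coanchor p (-(L.form p z ∘ₗ A.toFun p))

variable {lam}

/-- The adapted formula says that the defect `ρ(z) - λY_z` is `-½ π^* c(z, A·)`; its pairings see
only the connection component of the anchor. -/
theorem IsAdapted.pairing {A : Connection EG G EP P} (hA : lam.IsAdapted A)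
    (z : GroupLieAlgebra 𝓘(ℝ, EG) G) (p : P) (e : E p) :
    C.pairing p ((L.rho z - lam.liftHom (L.vert z)) p) e =
      -(1 / 2) * L.form p z (A.toFun p (C.anchor p e)) := by
  rw [ContMDiffSection.coe_sub, Pi.sub_apply, liftHom_apply, L.vert_apply, hA z p,
    add_sub_cancel_left, map_smul, LinearMap.smul_apply, C.pairing_coanchor]
  simp

/-- The contraction of the curvature with an infinitesimal action, for vector fields with flat
vertical parts. -/
theorem IsAdapted.curvature_vert [LieGroup 𝓘(ℝ, EG) ∞ G] {A : Connection EG G EP P}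
    (hA : lam.IsAdapted A) (z : GroupLieAlgebra 𝓘(ℝ, EG) G) (X W : VectorFields (EM := EP) P)
    (hX : ∀ t p, C.pairing p (C.bracket t (L.rho z - lam.liftHom (L.vert z)) p)
      (lam.liftHom X p) + C.pairing p ((L.rho z - lam.liftHom (L.vert z)) p)
        (C.bracket t (lam.liftHom X) p) = 0)
    (hW : ∀ t p, C.pairing p (C.bracket t (L.rho z - lam.liftHom (L.vert z)) p)
      (lam.liftHom W p) + C.pairing p ((L.rho z - lam.liftHom (L.vert z)) p)
        (C.bracket t (lam.liftHom W) p) = 0) (p : P) :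
    lam.curvature (L.vert z) X W p =
      L.form p z (A.toFun p (C.anchor p (C.bracket (lam.liftHom X) (lam.liftHom W) p))) := by
  rw [← curvatureTrilinear_eq, curvatureTrilinear_apply]
  set r := L.rho z - lam.liftHom (L.vert z) with hr
  have h0 : lam.liftHom (L.vert z) = L.rho z - r := by rw [hr]; abel
  -- In `λY_z = ρ(z) - r` the term of `ρ(z)` drops out by isotropy. For `r`, polarization (`h2`) and
  -- the two flatness hypotheses reduce `⟨[r, λX], λW⟩` to `⟨r, [λX, λW]⟩`.
  have h1 : C.pairing p (C.bracket (L.rho z) (lam.liftHom X) p) (lam.liftHom W p) = 0 := by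
    rw [lam.bracket_rho_liftHom z X p]
    exact lam.isotropic p _ _
  have h2 := C.pairing_bracket_add_bracket r (lam.liftHom X) (lam.liftHom W) p
  have h3 := hX (lam.liftHom W) p
  have h4 := hW (lam.liftHom X) p
  have h5 := hA.pairing z p (C.bracket (lam.liftHom X) (lam.liftHom W) p)
  rw [← hr] at h5
  have h6 := C.pairing_comm p (r p) (C.bracket (lam.liftHom W) (lam.liftHom X) p)
  rw [h0, map_sub, LinearMap.sub_apply, ContMDiffSection.coe_sub, Pi.sub_apply, map_sub,
    LinearMap.sub_apply]
  linarith

/-- The defect `ρ(z) - λY_z` is orthogonal to lifts of horizontal fields, so the pairing being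
differentiated is zero. -/
theorem IsAdapted.flat_of_horizontal {A : Connection EG G EP P}
    (hA : lam.IsAdapted A) (z : GroupLieAlgebra 𝓘(ℝ, EG) G) (X : VectorFields (EM := EP) P)
    (hX : ∀ q, A.toFun q (X q) = 0) (t : Sections (EP := EP) F E) (p : P) :
    C.pairing p (C.bracket t (L.rho z - lam.liftHom (L.vert z)) p) (lam.liftHom X p) +
      C.pairing p ((L.rho z - lam.liftHom (L.vert z)) p) (C.bracket t (lam.liftHom X) p) = 0 := by
  refine C.invariant_of_eq_zero (fun q => ?_) t p
  rw [hA.pairing, anchor_liftHom, hX, map_zero, mul_zero]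

/-- The pairing being differentiated is `-½ c(z, w) = ⟨ρ(½z), ρ(w)⟩`, and such pairings have zero
derivative by `invariant_rho`. -/
theorem IsAdapted.flat_of_vertical {A : Connection EG G EP P}
    (hA : lam.IsAdapted A) (z w : GroupLieAlgebra 𝓘(ℝ, EG) G)
    (t : Sections (EP := EP) F E) (p : P) :
    C.pairing p (C.bracket t (L.rho z - lam.liftHom (L.vert z)) p) (lam.liftHom (L.vert w) p) +
      C.pairing p ((L.rho z - lam.liftHom (L.vert z)) p)
        (C.bracket t (lam.liftHom (L.vert w)) p) = 0 := by
  rw [C.invariant_congr (s' := L.rho ((1 / 2 : ℝ) • z)) (t' := L.rho w) (fun q => ?_) t p,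
    L.invariant_rho]
  rw [hA.pairing, anchor_liftHom, L.vert_apply, A.vertical, L.form_apply, map_smul,
    ContMDiffSection.coe_smul, Pi.smul_apply, map_smul, LinearMap.smul_apply, smul_eq_mul]
  ring

/-- The curvature of an adapted splitting differs from `-CS(A)` by its horizontal part. -/
theorem IsAdapted.curvature_eq [LieGroup 𝓘(ℝ, EG) ∞ G] [FiniteDimensional ℝ EG]
    {A : Connection EG G EP P} (hA : lam.IsAdapted A) (X Y Z : VectorFields (EM := EP) P) (p : P) :
    lam.curvature X Y Z p = -chernSimons L A X Y Z p +
      lam.curvature (A.horField L X) (A.horField L Y) (A.horField L Z) p := by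
  set hX := A.horField L X
  set hY := A.horField L Y
  set hZ := A.horField L Z
  have horX : ∀ W : VectorFields (EM := EP) P, ∀ q,
      A.toFun q (A.horField L W q) = 0 := fun W q => by
    rw [A.horField_apply, A.toFun_hor]
  have hvhh : ∀ z (U W : VectorFields (EM := EP) P),
      lam.curvature (L.vert z) (A.horField L U) (A.horField L W) p =
        -L.form p z (A.curv U W p) := by
    intro z U W
    rw [hA.curvature_vert z _ _ (hA.flat_of_horizontal z _ (horX U))
      (hA.flat_of_horizontal z _ (horX W)), C.anchor_bracket]
    simp only [anchor_liftHom, A.horField_apply]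
    rw [Connection.curv, map_neg, neg_neg]
  have hvvh : ∀ z w (W : VectorFields (EM := EP) P),
      lam.curvature (L.vert z) (L.vert w) (A.horField L W) p = 0 := by
    intro z w W
    rw [hA.curvature_vert z _ _ (hA.flat_of_vertical z w) (hA.flat_of_horizontal z _ (horX W)),
      C.anchor_bracket_congr (s' := L.rho w) (t' := lam.liftHom (A.horField L W))
        (fun q => by rw [anchor_liftHom]; rfl) (fun q => rfl),
      lam.connection_bracket_rho_liftHom A w _ (horX W), map_zero]
  have hvvv : ∀ x y z, lam.curvature (L.vert x) (L.vert y) (L.vert z) p = L.form p x ⁅y, z⁆ := by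
    intro x y z
    rw [hA.curvature_vert x _ _ (hA.flat_of_vertical x y) (hA.flat_of_vertical x z),
      C.anchor_bracket_congr (s' := L.rho y) (t' := L.rho z)
        (fun q => by rw [anchor_liftHom]; rfl) (fun q => by rw [anchor_liftHom]; rfl),
      ← L.map_bracket, L.anchor_rho, A.vertical]
  have swap01 : ∀ U V W : VectorFields (EM := EP) P,
      lam.curvature U V W p = -lam.curvature V U W p := fun U V W =>
    (lam.curvatureAlternating p).map_swap ![V, U, W] (i := 0) (j := 1) (by decide)
  have swap12 : ∀ U V W : VectorFields (EM := EP) P,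
      lam.curvature U V W p = -lam.curvature U W V p := fun U V W =>
    (lam.curvatureAlternating p).map_swap ![U, W, V] (i := 1) (j := 2) (by decide)
  -- The vertical parts are extended from `p` by infinitesimal actions of fixed Lie algebra
  -- elements, to which the flatness lemmas apply. These fields agree with `X`, `Y`, `Z` only at
  -- `p`, which suffices by tensoriality.
  have key : lam.curvature X Y Z p = lam.curvatureTrilinear p
      (hX + L.vert (A.toFun p (X p))) (hY + L.vert (A.toFun p (Y p)))
      (hZ + L.vert (A.toFun p (Z p))) := by
    have hdec : ∀ W : VectorFields (EM := EP) P,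
        W p = (A.horField L W + L.vert (A.toFun p (W p))) p := fun W => by
      rw [ContMDiffSection.coe_add, Pi.add_apply, A.horField_apply, L.vert_apply, A.hor_apply,
        sub_add_cancel]
    refine lam.curvatureAlternating_congr p (X := ![X, Y, Z]) (Y := ![_, _, _]) fun i => ?_
    obtain rfl | rfl | rfl := fin_three_cases i
    exacts [hdec X, hdec Y, hdec Z]
  rw [key]
  simp only [map_add, LinearMap.add_apply, curvatureTrilinear_eq]
  rw [hvvv, swap12 (L.vert _) hY (L.vert _), hvvh, swap01 hX (L.vert _) (L.vert _),
    swap12 (L.vert _) hX (L.vert _), hvvh, hvvh, swap01 hX (L.vert _) hZ, hvhh,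
    swap12 hX hY (L.vert _), swap01 hX (L.vert _) hY, hvhh, hvhh, chernSimons,
    L.form_comm p (A.curv X Y p), L.form_comm p (A.curv X Z p), L.form_comm p (A.curv Y Z p)]
  ring

end Preferred

end Splitting

end Curvature

/-! ### Adapted splittings -/

section Adapted

variable {EG : Type*} [NormedAddCommGroup EG] [NormedSpace ℝ EG]
  {G : Type*} [TopologicalSpace G] [ChartedSpace EG G] [Group G]
  {EM : Type*} [NormedAddCommGroup EM] [NormedSpace ℝ EM]
  {M : Type*} [TopologicalSpace M] [ChartedSpace EM M]
  {EP : Type*} [NormedAddCommGroup EP] [NormedSpace ℝ EP]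
  {P : Type*} [TopologicalSpace P] [ChartedSpace EP P] [IsManifold 𝓘(ℝ, EP) ∞ P]
  [MulAction Gᵐᵒᵖ P]
  {F : Type*} [NormedAddCommGroup F] [NormedSpace ℝ F]
  {E : P → Type*} [TopologicalSpace (TotalSpace F E)]
  [∀ p, TopologicalSpace (E p)] [∀ p, AddCommGroup (E p)] [∀ p, Module ℝ (E p)]
  [FiberBundle F E] [VectorBundle ℝ F E] {C : CourantAlgebroid (EP := EP) F E}
  {L : EquivariantLift EG G C} {pr : P → M}

/-- The push-forward of a smooth section by an element of the group. -/
theorem RightAction.exists_push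
    (hP : IsPrincipalBundle (EG := EG) (EM := EM) (EP := EP) G pr) (R : RightAction EG G C) (g : G)
    (s : Sections (EP := EP) F E) :
    ∃ s' : Sections (EP := EP) F E, ∀ p, R.toFun g p (s p) = s' (op g • p) := by
  -- The pushed-forward section at `q` lies over `(q · g⁻¹) · g`, equal to `q` only propositionally.
  -- Smoothness is shown in the total space, and the values are then transported to the fibre over
  -- `q`.
  let Θ : P → TotalSpace F E := fun q =>
    ⟨op g • op g⁻¹ • q, R.toFun g (op g⁻¹ • q) (s (op g⁻¹ • q))⟩
  have hΘ : ContMDiff 𝓘(ℝ, EP) (𝓘(ℝ, EP).prod 𝓘(ℝ, F)) ∞ Θ :=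
    R.smooth.comp ((contMDiff_const (c := g)).prodMk
      (s.contMDiff.comp (hP.contMDiff_smul g⁻¹)))
  have hproj : ∀ q, (Θ q).1 = q := fun q => by
    change op g • op g⁻¹ • q = q
    rw [← mul_smul, ← op_mul, inv_mul_cancel, op_one, one_smul]
  have hex : ∀ q, ∃ e : E q, (⟨q, e⟩ : TotalSpace F E) = Θ q := fun q =>
    ⟨hproj q ▸ (Θ q).2, by
      have : ∀ (x : TotalSpace F E) (h : x.1 = q), (⟨q, h ▸ x.2⟩ : TotalSpace F E) = x := by
        rintro x rfl; rfl
      exact this _ _⟩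
  choose s' hs' using hex
  refine ⟨⟨s', by simpa only [hs'] using hΘ⟩, fun p => ?_⟩
  have h1 : (⟨op g • p, s' (op g • p)⟩ : TotalSpace F E) = ⟨op g • p, R.toFun g p (s p)⟩ := by
    rw [hs']
    have : ∀ q, q = p → (⟨op g • q, R.toFun g q (s q)⟩ : TotalSpace F E) =
        ⟨op g • p, R.toFun g p (s p)⟩ := by rintro _ rfl; rfl
    refine this _ ?_
    rw [← mul_smul, ← op_mul, mul_inv_cancel, op_one, one_smul]
  exact (TotalSpace.mk_inj.1 h1).symm

namespace Splitting

variable {lam : Splitting L}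

/-- Lift the field by `λ`, push the section forward and project by the anchor, which intertwines the
two actions. -/
theorem exists_push (hP : IsPrincipalBundle (EG := EG) (EM := EM) (EP := EP) G pr)
    (lam : Splitting L) (g : G) (X : VectorFields (EM := EP) P) :
    ∃ X' : VectorFields (EM := EP) P, ∀ p, X' (op g • p) = dAct g p (X p) := by
  obtain ⟨s', hs'⟩ := L.act.exists_push hP g (lam.lift X)
  refine ⟨⟨fun p => C.anchor p (s' p), C.anchor_smooth s'⟩, fun p => ?_⟩
  change C.anchor _ (s' _) = _
  rw [← hs' p, L.act.map_anchor]
  exact congrArg _ (lam.anchor_splitting p _)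

/-- The curvature of an equivariant splitting is invariant. -/
theorem curvature_push (lam : Splitting L) (g : G) {X Y Z X' Y' Z' : VectorFields (EM := EP) P}
    (hX : ∀ p, X' (op g • p) = dAct g p (X p)) (hY : ∀ p, Y' (op g • p) = dAct g p (Y p))
    (hZ : ∀ p, Z' (op g • p) = dAct g p (Z p)) (p : P) :
    lam.curvature X' Y' Z' (op g • p) = lam.curvature X Y Z p := by
  have h : ∀ {W W' : VectorFields (EM := EP) P}, (∀ p, W' (op g • p) = dAct g p (W p)) →
      ∀ p, L.act.toFun g p (lam.lift W p) = lam.lift W' (op g • p) := fun {W W'} hW p => by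
    change _ = lam.toFun _ (W' _)
    rw [hW, lam.equivariant]
    rfl
  rw [Splitting.curvature, Splitting.curvature, ← L.act.map_bracket g _ _ _ _ (h hX) (h hY) p,
    ← h hZ, L.act.map_pairing]

variable [IsManifold 𝓘(ℝ, EM) ∞ M] [FiniteDimensional ℝ EP] [T2Space P]
  [FiniteDimensional ℝ EG] [LieGroup 𝓘(ℝ, EG) ∞ G] [FiniteDimensional ℝ F]

/-- The curvature of a splitting that is adapted to `A` is `-CS(A)` up to a form on the base. -/
theorem IsAdapted.exists_isPreferred
    (hP : IsPrincipalBundle (EG := EG) (EM := EM) (EP := EP) G pr) {A : Connection EG G EP P}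
    (hA : lam.IsAdapted A) : ∃ H : DiffForm (EM := EM) M 3, IsPreferred pr A lam H := by
  choose ext hext using fun p : P =>
    exists_linear_extension (EB := EP) (F := EP) (V := fun p : P => TangentSpace 𝓘(ℝ, EP) p) p
  -- `T` is the curvature evaluated on horizontal parts. By tensoriality the pointwise chosen
  -- extensions do not matter (`hT`), so smoothness may be tested on horizontal fields and
  -- invariance on push-forwards.
  obtain ⟨T, hT₀⟩ : ∃ T : ∀ p : P, TangentSpace 𝓘(ℝ, EP) p [⋀^Fin 3]→ₗ[ℝ] ℝ, ∀ p u,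
      T p u = lam.curvatureAlternating p (fun i => ext p (A.hor p (u i))) :=
    ⟨fun p => (lam.curvatureAlternating p).compLinearMap (ext p ∘ₗ A.hor p), fun p u => rfl⟩
  have hT : ∀ p (u : Fin 3 → TangentSpace 𝓘(ℝ, EP) p) (X : Fin 3 → VectorFields (EM := EP) P),
      (∀ i, X i p = A.hor p (u i)) → T p u = lam.curvature (X 0) (X 1) (X 2) p := by
    intro p u X hX
    have h2 : ∀ i, (fun i => ext p (A.hor p (u i))) i p = X i p := fun i => by
      rw [hX i]
      exact hext p _
    rw [hT₀, lam.curvatureAlternating_congr p h2, curvatureAlternating_apply]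
  obtain ⟨H, hH⟩ := hP.exists_pullback_eq T
    (fun X => by
      have e : ∀ p, T p (fun i => X i p) = lam.curvature (A.horField L (X 0))
          (A.horField L (X 1)) (A.horField L (X 2)) p := fun p =>
        hT p _ (fun i => A.horField L (X i)) fun i => A.horField_apply L (X i) p
      simp only [e]
      exact contMDiff_const.mul (C.pairing_smooth _ _))
    (fun g p u => by
      choose X' hX' using fun i => lam.exists_push hP g (ext p (A.hor p (u i)))
      rw [hT p u (fun i => ext p (A.hor p (u i))) (fun i => hext p _),
        hT (op g • p) _ X' (fun i => by rw [hX', hext, A.hor_dAct L])]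
      exact lam.curvature_push g (hX' 0) (hX' 1) (hX' 2) p)
    (fun p u i z hz => by
      rw [hT₀]
      refine (lam.curvatureAlternating p).map_coord_zero i ?_
      simp only [hz, A.hor_infAct, map_zero])
  refine ⟨H, hA, fun X Y Z p => ?_⟩
  rw [hA.curvature_eq, hH, hT p _ ![A.horField L X, A.horField L Y, A.horField L Z] fun i => ?_]
  · rfl
  · obtain rfl | rfl | rfl := fin_three_cases i <;> exact A.horField_apply L _ p

end Splitting

/-! ### Transformations of splittings by 2-forms -/

/-- The contraction of a 2-form, as a linear map. -/
def contractHom {V : Type*} [AddCommGroup V] [Module ℝ V] (β : V [⋀^Fin 2]→ₗ[ℝ] ℝ) :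
    V →ₗ[ℝ] Module.Dual ℝ V where
  toFun := contract β
  map_add' v v' := by
    ext w
    have h := β.map_update_add ![0, w] 0 v v'
    have e : ∀ u, Function.update ![0, w] 0 u = ![u, w] := fun u => by
      ext i; fin_cases i <;> simp
    rw [e, e, e] at h
    exact h
  map_smul' a v := by
    ext w
    have h := β.map_update_smul ![0, w] 0 a v
    have e : ∀ u, Function.update ![0, w] 0 u = ![u, w] := fun u => by
      ext i; fin_cases i <;> simp
    rw [e, e] at h
    exact h

theorem contract_apply {V : Type*} [AddCommGroup V] [Module ℝ V] (β : V [⋀^Fin 2]→ₗ[ℝ] ℝ)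
    (v w : V) : contract β v w = β ![v, w] := rfl

theorem contract_swap {V : Type*} [AddCommGroup V] [Module ℝ V] (β : V [⋀^Fin 2]→ₗ[ℝ] ℝ)
    (v w : V) : contract β v w = -contract β w v := by
  have h := β.map_swap ![w, v] (i := 0) (j := 1) (by decide)
  have e : ![w, v] ∘ Equiv.swap (0 : Fin 2) 1 = ![v, w] := by
    ext i; fin_cases i <;> rfl
  rw [e] at h
  exact h

namespace Splitting

variable [FiniteDimensional ℝ F] {lam : Splitting L}

/-- The pairing in terms of an isotropic splitting. -/
theorem pairing_eq (lam : Splitting L) (hC : C.IsExact) (p : P) (e e' : E p) :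
    C.pairing p e e' = C.pairing p e (lam.toFun p (C.anchor p e')) +
      C.pairing p (lam.toFun p (C.anchor p e)) e' := by
  -- Both `e - λπe` and `e' - λπe'` lie in the kernel of the anchor, which is isotropic.
  have h := hC.pairing_eq_zero (p := p) (e := e - lam.toFun p (C.anchor p e))
    (e' := e' - lam.toFun p (C.anchor p e')) (by rw [map_sub, lam.anchor_splitting, sub_self])
    (by rw [map_sub, lam.anchor_splitting, sub_self])
  simp only [map_sub, LinearMap.sub_apply, lam.isotropic] at h
  linarith

variable [FiniteDimensional ℝ EP] [T2Space P] [ContMDiffVectorBundle ∞ F E 𝓘(ℝ, EP)]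

/-- The transformation `e^B λ` of a splitting by an invariant 2-form `B`. -/
theorem exists_transform (lam : Splitting L) (hC : C.IsExact)
    (B : ∀ p : P, TangentSpace 𝓘(ℝ, EP) p [⋀^Fin 2]→ₗ[ℝ] ℝ)
    (hB : ∀ X : Fin 2 → VectorFields (EM := EP) P,
      ContMDiff 𝓘(ℝ, EP) 𝓘(ℝ, ℝ) ∞ (fun p => B p (fun i => X i p)))
    (hinv : ∀ (g : G) (p : P) (u : Fin 2 → TangentSpace 𝓘(ℝ, EP) p),
      B (op g • p) (fun i => dAct g p (u i)) = B p u) :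
    ∃ lam' : Splitting L, ∀ p v, lam'.toFun p v =
      lam.toFun p v + (1 / 2 : ℝ) • C.coanchor p (contract (B p) v) := by
  have hBv : ∀ X Y : VectorFields (EM := EP) P,
      ContMDiff 𝓘(ℝ, EP) 𝓘(ℝ, ℝ) ∞ (fun p => B p ![X p, Y p]) := fun X Y => by
    refine (hB ![X, Y]).congr fun p => congrArg (B p) ?_
    ext i; fin_cases i <;> rfl
  have hsm : ∀ X : VectorFields (EM := EP) P,
      ContMDiff 𝓘(ℝ, EP) (𝓘(ℝ, EP).prod 𝓘(ℝ, F)) ∞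
        (fun p => (⟨p, C.coanchor p (contract (B p) (X p))⟩ : TotalSpace F E)) := fun X => by
    refine contMDiff_of_pairing C.pairing C.pairing_nondegenerate C.pairing_smooth _ fun t => ?_
    simp only [C.pairing_coanchor, contract_apply]
    exact hBv X ⟨_, C.anchor_smooth t⟩
  refine ⟨⟨fun p => lam.toFun p + (1 / 2 : ℝ) • (C.coanchor p ∘ₗ contractHom (B p)),
    fun X => (lam.smooth X).add_section ((hsm X).const_smul_section (a := (1 / 2 : ℝ))),
    fun p v => ?_, fun p v w => ?_, fun g p v => ?_⟩, fun p v => rfl⟩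
  · change C.anchor p (lam.toFun p v + (1 / 2 : ℝ) • C.coanchor p (contract (B p) v)) = v
    rw [map_add, map_smul, hC.anchor_coanchor, lam.anchor_splitting, smul_zero, add_zero]
  · change C.pairing p (lam.toFun p v + (1 / 2 : ℝ) • C.coanchor p (contract (B p) v))
      (lam.toFun p w + (1 / 2 : ℝ) • C.coanchor p (contract (B p) w)) = 0
    simp only [map_add, map_smul, LinearMap.add_apply, LinearMap.smul_apply, lam.isotropic,
      C.pairing_coanchor, lam.anchor_splitting, hC.anchor_coanchor, map_zero]
    rw [C.pairing_comm p (lam.toFun p v), C.pairing_coanchor, lam.anchor_splitting,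
      contract_swap (B p) w v]
    simp
  · change lam.toFun _ (dAct g p v) + (1 / 2 : ℝ) • C.coanchor _ (contract (B _) (dAct g p v)) =
      L.act.toFun g p (lam.toFun p v + (1 / 2 : ℝ) • C.coanchor p (contract (B p) v))
    rw [map_add, lam.equivariant, map_smul]
    congr 2
    refine C.ext_pairing fun f => ?_
    obtain ⟨e, rfl⟩ := (L.act.toFun g p).surjective f
    rw [L.act.map_pairing, C.pairing_coanchor, C.pairing_coanchor, L.act.map_anchor,
      contract_apply, contract_apply, ← hinv g p]
    congr 1
    ext i; fin_cases i <;> rfl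

variable [FiniteDimensional ℝ EG] [LieGroup 𝓘(ℝ, EG) ∞ G]

/-- Every connection has an adapted splitting. -/
theorem exists_isAdapted (lam : Splitting L) (hC : C.IsExact) (A : Connection EG G EP P) :
    ∃ lam' : Splitting L, lam'.IsAdapted A := by
  let r : ∀ p : P, TangentSpace 𝓘(ℝ, EP) p →ₗ[ℝ] E p := fun p => L.rhoAt p ∘ₗ A.toFun p
  have hr : ∀ (g : G) p v, r (op g • p) (dAct g p v) = L.act.toFun g p (r p v) := fun g p v => by
    change L.rho (A.toFun _ (dAct g p v)) _ = L.act.toFun g p (L.rho (A.toFun p v) p)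
    rw [A.equivariant, L.act_rho]
  -- By `pairing_eq` the last two terms equal `⟨λπ r v, r w⟩ - ⟨r v, λπ r w⟩`, so `f` is skew. For
  -- `v = Y_z` they combine with the second to `-⟨ρ(z), r w⟩ = c(z, Aw)`, giving the value forced by
  -- the adapted formula; for `v`, `w` horizontal, `f` is zero.
  let f : ∀ p : P, TangentSpace 𝓘(ℝ, EP) p →ₗ[ℝ] TangentSpace 𝓘(ℝ, EP) p →ₗ[ℝ] ℝ := fun p =>
    (2 : ℝ) • (C.pairing p).compl₁₂ (r p) (lam.toFun p) -
      (2 : ℝ) • ((C.pairing p).compl₁₂ (lam.toFun p) (r p)) -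
      (2 : ℝ) • (C.pairing p).compl₁₂ (r p) (lam.toFun p ∘ₗ C.anchor p ∘ₗ r p) +
      (C.pairing p).compl₁₂ (r p) (r p)
  have hf : ∀ p v w, f p v w = 2 * C.pairing p (r p v) (lam.toFun p w) -
      2 * C.pairing p (lam.toFun p v) (r p w) -
      2 * C.pairing p (r p v) (lam.toFun p (C.anchor p (r p w))) +
      C.pairing p (r p v) (r p w) := fun p v w => rfl
  have hff : ∀ p v, f p v v = 0 := fun p v => by
    have h1 := lam.pairing_eq hC p (r p v) (r p v)
    have h2 := C.pairing_comm p (r p v) (lam.toFun p v)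
    have h3 := C.pairing_comm p (r p v) (lam.toFun p (C.anchor p (r p v)))
    rw [hf]
    linarith
  obtain ⟨lam', hlam'⟩ := lam.exists_transform hC (fun p => alternatingTwo (f p) (hff p))
    (fun X => by
      refine (((contMDiff_const (c := (2 : ℝ))).mul
        (C.pairing_smooth (A.rhoSection L (X 0)) (lam.lift (X 1)))).sub
        (contMDiff_const.mul (C.pairing_smooth (lam.lift (X 0)) (A.rhoSection L (X 1)))) |>.sub
        (contMDiff_const.mul (C.pairing_smooth (A.rhoSection L (X 0))
          (lam.lift ⟨_, C.anchor_smooth (A.rhoSection L (X 1))⟩)))).add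
        (C.pairing_smooth (A.rhoSection L (X 0)) (A.rhoSection L (X 1))))
    (fun g p u => by
      change f _ (dAct g p (u 0)) (dAct g p (u 1)) = f p (u 0) (u 1)
      rw [hf, hf, hr, hr, L.act.map_anchor, lam.equivariant, lam.equivariant, lam.equivariant,
        L.act.map_pairing, L.act.map_pairing, L.act.map_pairing, L.act.map_pairing])
  refine ⟨lam', fun z p => C.ext_pairing fun e => ?_⟩
  have h1 := lam.pairing_eq hC p (L.rho z p) e
  have h2 := lam.pairing_eq hC p (L.rho z p) (r p (C.anchor p e))
  have h3 : contract (alternatingTwo (f p) (hff p)) (infAct p z) (C.anchor p e) =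
      f p (infAct p z) (C.anchor p e) := rfl
  have h4 : r p (infAct p z) = L.rho z p := by
    change L.rho (A.toFun p (infAct p z)) p = _
    rw [A.vertical]
  have h5 : L.form p z (A.toFun p (C.anchor p e)) =
    -C.pairing p (L.rho z p) (r p (C.anchor p e)) := rfl
  rw [L.anchor_rho] at h1 h2
  rw [hlam']
  simp only [map_add, map_smul, LinearMap.add_apply, LinearMap.smul_apply, C.pairing_coanchor,
    smul_eq_mul, h3, hf, h4, LinearMap.neg_apply, LinearMap.comp_apply, h5]
  linarith

end Splitting

/-! ### Pullbacks of forms and uniqueness -/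

variable [IsManifold 𝓘(ℝ, EM) ∞ M]

/-- The images of a field under the derivative of `pr` form a section along `pr`, in general not a
field on `M`, whence `contMDiffAt_multilinear`. -/
theorem contMDiff_pullback [FiniteDimensional ℝ EM] [T2Space M]
    (hP : IsPrincipalBundle (EG := EG) (EM := EM) (EP := EP) G pr) {k : ℕ}
    (b : DiffForm (EM := EM) M k) (X : Fin k → VectorFields (EM := EP) P) :
    ContMDiff 𝓘(ℝ, EP) 𝓘(ℝ, ℝ) ∞ (fun p => pullback pr b p (fun i => X i p)) := by
  intro p
  refine contMDiffAt_multilinear (F := EM) (V := fun x : M => TangentSpace 𝓘(ℝ, EM) x)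
    (fun x => (b.toFun x).toMultilinearMap) b.smooth (f := pr)
    (u := fun p i => mfderiv 𝓘(ℝ, EP) 𝓘(ℝ, EM) pr p (X i p)) hP.smooth_proj.contMDiffAt fun i => ?_
  exact ((hP.smooth_proj.contMDiff_tangentMap (m := ∞) (by simp)).comp
    (X i).contMDiff).contMDiffAt

theorem Splitting.IsAdapted.exists_isBasicBTransform [FiniteDimensional ℝ EP] [T2Space P]
    [LieGroup 𝓘(ℝ, EG) ∞ G] [FiniteDimensional ℝ F]
    (hP : IsPrincipalBundle (EG := EG) (EM := EM) (EP := EP) G pr) (hC : C.IsExact)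
    {A : Connection EG G EP P} {lam lam' : Splitting L} (h : lam.IsAdapted A)
    (h' : lam'.IsAdapted A) :
    ∃ b : DiffForm (EM := EM) M 2, IsBasicBTransform pr b lam lam' := by
  -- If `λ' = λ + ½ π^* i_v b`, pairing with `λw` gives `½ b(v, w)`; hence the factor `2`.
  let f : ∀ p : P, TangentSpace 𝓘(ℝ, EP) p →ₗ[ℝ] TangentSpace 𝓘(ℝ, EP) p →ₗ[ℝ] ℝ := fun p =>
    (2 : ℝ) • (C.pairing p).compl₁₂ (lam'.toFun p) (lam.toFun p)
  have hf : ∀ p v w, f p v w = 2 * C.pairing p (lam'.toFun p v) (lam.toFun p w) :=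
    fun p v w => rfl
  have hff : ∀ p v, f p v v = 0 := fun p v => by
    have h1 := lam.pairing_eq hC p (lam'.toFun p v) (lam'.toFun p v)
    rw [lam'.anchor_splitting, lam'.isotropic, C.pairing_comm p (lam.toFun p v)] at h1
    rw [hf]
    linarith
  -- The correction term in the formula for `ρ` does not involve the splitting, so both splittings
  -- agree on vertical vectors and `f` is horizontal.
  have heq : ∀ p z, lam'.toFun p (infAct p z) = lam.toFun p (infAct p z) := fun p z =>
    add_right_cancel ((h' z p).symm.trans (h z p))
  obtain ⟨b, hb⟩ := hP.exists_pullback_eq (fun p => alternatingTwo (f p) (hff p))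
    (fun X => contMDiff_const.mul (C.pairing_smooth (lam'.lift (X 0)) (lam.lift (X 1))))
    (fun g p u => by
      change f _ (dAct g p (u 0)) (dAct g p (u 1)) = f p (u 0) (u 1)
      rw [hf, hf, lam.equivariant, lam'.equivariant, L.act.map_pairing])
    (fun p u i z hz => by
      change f p (u 0) (u 1) = 0
      rw [hf]
      obtain rfl | rfl : i = 0 ∨ i = 1 := by fin_cases i <;> simp
      · rw [hz, heq, lam.isotropic, mul_zero]
      · rw [hz, ← heq, lam'.isotropic, mul_zero])
  refine ⟨b, fun p v => C.ext_pairing fun e => ?_⟩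
  have h1 := lam.pairing_eq hC p (lam'.toFun p v) e
  have h2 : contract (alternatingTwo (f p) (hff p)) v (C.anchor p e) =
    2 * C.pairing p (lam'.toFun p v) (lam.toFun p (C.anchor p e)) := rfl
  rw [lam'.anchor_splitting] at h1
  rw [hb, map_add, map_smul, LinearMap.add_apply, LinearMap.smul_apply, C.pairing_coanchor, h2,
    smul_eq_mul]
  linarith

end Adapted

end LiftedAction

theorem mainTheorem8
    {EG : Type*} [NormedAddCommGroup EG] [NormedSpace ℝ EG] [FiniteDimensional ℝ EG]
    {G : Type*} [TopologicalSpace G] [ChartedSpace EG G] [Group G] [LieGroup 𝓘(ℝ, EG) ∞ G]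
    {EM : Type*} [NormedAddCommGroup EM] [NormedSpace ℝ EM] [FiniteDimensional ℝ EM]
    {M : Type*} [TopologicalSpace M] [ChartedSpace EM M] [IsManifold 𝓘(ℝ, EM) ∞ M] [T2Space M]
    {EP : Type*} [NormedAddCommGroup EP] [NormedSpace ℝ EP] [FiniteDimensional ℝ EP]
    {P : Type*} [TopologicalSpace P] [ChartedSpace EP P] [IsManifold 𝓘(ℝ, EP) ∞ P] [T2Space P]
    [MulAction Gᵐᵒᵖ P] (pr : P → M)
    (hP : LiftedAction.IsPrincipalBundle (EG := EG) (EM := EM) (EP := EP) G pr)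
    {F : Type*} [NormedAddCommGroup F] [NormedSpace ℝ F] [FiniteDimensional ℝ F]
    {E : P → Type*} [TopologicalSpace (TotalSpace F E)]
    [∀ p, TopologicalSpace (E p)] [∀ p, AddCommGroup (E p)] [∀ p, Module ℝ (E p)]
    [FiberBundle F E] [VectorBundle ℝ F E] [ContMDiffVectorBundle ∞ F E 𝓘(ℝ, EP)]
    (C : LiftedAction.CourantAlgebroid (EP := EP) F E) (hC : C.IsExact)
    (L : LiftedAction.EquivariantLift EG G C)
    (hL : Nonempty (LiftedAction.Splitting L))
    (A : LiftedAction.Connection EG G EP P) :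
    (∃ (lam : LiftedAction.Splitting L) (H : LiftedAction.DiffForm (EM := EM) M 3),
      LiftedAction.IsPreferred pr A lam H) ∧
    (∀ (lam lam' : LiftedAction.Splitting L) (H H' : LiftedAction.DiffForm (EM := EM) M 3),
      LiftedAction.IsPreferred pr A lam H → LiftedAction.IsPreferred pr A lam' H' →
      ∃ b : LiftedAction.DiffForm (EM := EM) M 2,
        LiftedAction.IsBasicBTransform pr b lam lam') ∧
    (∀ (lam : LiftedAction.Splitting L) (H : LiftedAction.DiffForm (EM := EM) M 3)
      (b : LiftedAction.DiffForm (EM := EM) M 2), LiftedAction.IsPreferred pr A lam H →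
      ∃ (lam' : LiftedAction.Splitting L) (H' : LiftedAction.DiffForm (EM := EM) M 3),
        LiftedAction.IsBasicBTransform pr b lam lam' ∧ LiftedAction.IsPreferred pr A lam' H') := by
  open LiftedAction in
  refine ⟨?_, fun lam lam' H H' h h' => ?_, fun lam H b h => ?_⟩
  · obtain ⟨lam₀⟩ := hL
    obtain ⟨lam, hlam⟩ := lam₀.exists_isAdapted hC A
    exact ⟨lam, hlam.exists_isPreferred hP⟩
  · exact Splitting.IsAdapted.exists_isBasicBTransform hP hC (A := A) h.rho_eq h'.rho_eq
  · obtain ⟨lam', hlam'⟩ := lam.exists_transform hC (pullback pr b) (contMDiff_pullback hP b)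
      (pullback_dAct hP b)
    -- A form pulled back from `M` is killed by `Y_z`, so `λ'Y_z = λY_z`.
    have hA : lam'.IsAdapted A := fun z p => by
      rw [hlam', contract_pullback_infAct hP, map_zero, smul_zero, add_zero]
      exact h.rho_eq z p
    obtain ⟨H', hH'⟩ := hA.exists_isPreferred hP
    exact ⟨lam', H', hlam', hH'⟩
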